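/- **Data model.** Let $\mathcal I$, $\mathcal L$, $\mathcal V$ be countably infinite, pairwise disjoint sets of identifiers, constant literals and query variables, each with a fixed enumeration. A data triple is an element of $\mathcal I\times\mathcal I\times(\mathcal I\cup\mathcal L)$; $\mathrm{ids}(t)$ is the set of identifiers in $t$. A Web of Linked Data is a tuple $W=(D,\mathrm{data},\mathrm{adoc})$ where $D$ is a finite or countably infinite set of documents, $\mathrm{data}$ maps each $d\in D$ to a finite set of data triples, and $\mathrm{adoc}:\mathcal I\rightharpoonup D$ is a partial surjective mapping. $W$ is finite if $D$ is finite. A set $D'\subseteq D$ induces the subweb with documents $D'$, the restriction of $\mathrm{data}$ to $D'$, and the restriction of $\mathrm{adoc}$ to those $u$ with $\mathrm{adoc}(u)\in D'$. $\mathrm{AllData}(W)=\bigcup_{d\in D}\mathrm{data}(d)$. **Queries.** A basic query pattern (BQP) is a finite set $B\subset(\mathcal V\cup\mathcal I)\times(\mathcal V\cup\mathcal I)\times(\mathcal V\cup\mathcal I\cup\mathcal L)$; $\mathrm{vars}(B)$ is the set of its variables. A reachability criterion is a (total) Turing-computable function $c$ that maps a data triple, an identifier and a BQP to true or false. A CLD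 query $Q=Q^{B,S}_c$ is given by a BQP $B$, a finite set $S\subset\mathcal I$ of seed identifiers, and a reachability criterion $c$. A document $d$ of $W$ is $(c,B)$-reachable from $S$ if $d=\mathrm{adoc}(u)$ for some $u\in S$, or if there are a reachable document $d'$, a triple $t\in\mathrm{data}(d')$ and $u\in\mathrm{ids}(t)$ with $c(t,u,B)=\mathrm{true}$ and $\mathrm{adoc}(u)=d$. The $(S,c,B)$-reachable part of $W$ is the subweb induced by all reachable documents. The result $Q(W)$ is the set of all valuations $\mu:\mathcal V\rightharpoonup\mathcal I\cup\mathcal L$ with $\mathrm{dom}(\mu)=\mathrm{vars}(B)$ such that $\mu[B]$ (replace each variable $v$ by $\mu(v)$) is contained in $\mathrm{AllData}$ of the reachable part. **Encodings.** Identifiers, literals and variables are encoded by nonempty binary words (different for different elements of $\mathcal I\cup\mathcal L$); $\mathrm{enc}(s,p,o)=\langle \mathrm{enc}(s),\mathrm{enc}(p),\mathrm{enc}(o)\rangle$; a finite set of triples is encoded as $\langle\!\langle \mathrm{enc}(t_1),\dots,\mathrm{enc}(t_n)\rangle\!\rangle$ in increasing order, and $\mathrm{enc}(d)=\mathrm{enc}(\mathrm{data}(d))$;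 $\mathrm{enc}(W)$ is the possibly infinite word $\sharp\,\mathrm{enc}(u_1)\,\mathrm{enc}(\mathrm{adoc}(u_1))\,\sharp\,\mathrm{enc}(u_2)\,\mathrm{enc}(\mathrm{adoc}(u_2))\,\sharp\cdots$ where $u_1,u_2,\dots$ are the elements of $\mathrm{dom}(\mathrm{adoc})$ in increasing order; $\mathrm{enc}(\mu)=\langle\!\langle \mathrm{enc}(v_1)\to\mathrm{enc}(\mu(v_1)),\dots\rangle\!\rangle$ with the variables in increasing order; a possible encoding of a set of valuations is the concatenation of the encodings of its elements, each once, in any order. **Machines.** An LD machine is a deterministic multi-tape Turing machine with finitely many states, one of them called expand, and five tapes: a read-only ordinary input tape; a Web tape; a two-way infinite work tape; a right-infinite link traversal (work) tape; and an append-only output tape. Initially the Web tape contains $\mathrm{enc}(W)$ and all other tapes are empty. The Web tape is accessed only in the expand state: there, if the maximal binary suffix of the word on the link traversal tape is $\mathrm{enc}(u)$ for some $u\in\mathcal I$ and the Web tape contains $\sharp\,\mathrm{enc}(u)\,\mathrm{enc}(\mathrm{adoc}(u))\,\sharp$, the machine appends $\mathrm{enc}(\mathrm{adoc}(u))\,\sharp$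 to the word on the link traversal tape, and otherwise it appends $\sharp$; then it makes an ordinary step. We say that $M$ *computes the results of* $Q$ if for every Web of Linked Data $W'$ on whose encoding $M$ halts, the output of $M$ is a possible encoding of $Q(W')$. **Lemma.** Let $Q=Q^{B,S}_c$ be a CLD query. 1. There is an LD machine $M$, depending only on $Q$, that computes the results of $Q$ and that halts after finitely many steps on every Web of Linked Data $W$ whose $(S,c,B)$-reachable part is finite. 2. If $B$ contains at least one variable, then for every (possibly infinite) Web of Linked Data $W$ the following are equivalent: (a) there is an LD machine that computes the results of $Q$ and that, with $\mathrm{enc}(W)$ on its Web tape, halts after finitely many steps (and hence outputs a possible encoding of $Q(W)$); (b) the $(S,c,B)$-reachable part of $W$ is finite. -/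

import Mathlib

namespace LinkedData

/-! ## Data model

`I` (identifiers), `L` (constant literals) and `V` (query variables) are countably infinite types;
`I ⊕ L` is the disjoint union of identifiers and literals. -/

/-- A data triple: an element of `I × I × (I ∪ L)`. -/
abbrev DataTriple (I L : Type) : Type := I × I × (I ⊕ L)

/-- `u ∈ ids(t)`: the identifier `u` occurs in the data triple `t`. -/
def DataTriple.HasId {I L : Type} (t : DataTriple I L) (u : I) : Prop :=
  u = t.1 ∨ u = t.2.1 ∨ Sum.inl u = t.2.2

/-- A Web of Linked Data `(D, data, adoc)`. The partial mapping `adoc` is a total function into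
`Option D`. Since `adoc` is surjective, `D` is countable as soon as `I` is. -/
structure Web (I L : Type) where
  /-- the LD documents -/
  D : Type
  /-- the finite set of data triples of each document -/
  data : D → Finset (DataTriple I L)
  /-- the authoritative document of an identifier -/
  adoc : I → Option D
  adoc_surj : ∀ d : D, ∃ u : I, adoc u = some d

/-- A Web of Linked Data is finite if it has finitely many documents. -/
def Web.IsFinite {I L : Type} (W : Web I L) : Prop := Finite W.D

/-- The set of all data triples of a Web. -/
def Web.allData {I L : Type} (W : Web I L) : Set (DataTriple I L) :=
  {t | ∃ d : W.D, t ∈ W.data d}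

open Classical in
/-- The subweb of `W` induced by a set `D'` of documents. -/
noncomputable def Web.inducedSubweb {I L : Type} (W : Web I L) (D' : Set W.D) : Web I L where
  D := {d : W.D // d ∈ D'}
  data d := W.data d.1
  adoc u := (W.adoc u).bind fun d => if h : d ∈ D' then some ⟨d, h⟩ else none
  adoc_surj := by
    rintro ⟨d, hd⟩
    obtain ⟨u, hu⟩ := W.adoc_surj d
    exact ⟨u, by simp [hu, hd]⟩

/-! ## Query model -/

/-- A triple pattern: an element of `(V ∪ I) × (V ∪ I) × (V ∪ I ∪ L)`. -/
abbrev TriplePattern (I L V : Type) : Type := (V ⊕ I) × (V ⊕ I) × (V ⊕ (I ⊕ L))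

/-- The variable `v` occurs in the triple pattern. -/
def TriplePattern.HasVar {I L V : Type} (tp : TriplePattern I L V) (v : V) : Prop :=
  tp.1 = Sum.inl v ∨ tp.2.1 = Sum.inl v ∨ tp.2.2 = Sum.inl v

/-- The (finite) set of variables of a triple pattern, as a list. -/
def TriplePattern.varList {I L V : Type} (tp : TriplePattern I L V) : List V :=
  (tp.1.elim (fun v => [v]) fun _ => []) ++ (tp.2.1.elim (fun v => [v]) fun _ => []) ++
    (tp.2.2.elim (fun v => [v]) fun _ => [])

theorem TriplePattern.mem_varList {I L V : Type} (tp : TriplePattern I L V) (v : V) :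
    v ∈ tp.varList ↔ tp.HasVar v := by
  obtain ⟨a | a, b | b, c | c⟩ := tp <;> simp [varList, HasVar, eq_comm]

/-- A basic query pattern (BQP): a finite set of triple patterns. -/
abbrev BQP (I L V : Type) : Type := Finset (TriplePattern I L V)

open Classical in
/-- `vars(P)`, the finite set of variables of a BQP. -/
noncomputable def BQP.vars {I L V : Type} (P : BQP I L V) : Finset V :=
  P.biUnion fun tp => tp.varList.toFinset

theorem BQP.mem_vars {I L V : Type} (P : BQP I L V) (v : V) :
    v ∈ BQP.vars P ↔ ∃ tp ∈ P, TriplePattern.HasVar tp v := by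
  simp [BQP.vars, TriplePattern.mem_varList]

/-- A valuation: a partial mapping from variables to identifiers and literals. -/
abbrev Valuation (I L V : Type) : Type := V → Option (I ⊕ L)

/-- `μ[tp]`: replace the variables of `tp` according to `μ`. The result is undefined (`none`) if
some variable of `tp` is outside of `dom(μ)`. -/
def Valuation.subst {I L V : Type} (μ : Valuation I L V) (tp : TriplePattern I L V) :
    Option ((I ⊕ L) × (I ⊕ L) × (I ⊕ L)) :=
  (tp.1.elim μ fun u => some (Sum.inl u)).bind fun s =>
    (tp.2.1.elim μ fun u => some (Sum.inl u)).bind fun p =>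
      (tp.2.2.elim μ some).map fun o => (s, p, o)

/-- A reachability criterion: a (Turing) computable function that maps a data triple, an
identifier and a BQP to a truth value. Finite sets of triple patterns are presented to the
computation as lists. -/
structure ReachabilityCriterion (I L V : Type) [Denumerable I] [Denumerable L] [Denumerable V] where
  /-- the function -/
  toFun : DataTriple I L → I → BQP I L V → Bool
  computable_toFun : open Classical in
    Computable fun x : DataTriple I L × I × List (TriplePattern I L V) =>
      toFun x.1 x.2.1 x.2.2.toFinset

/-- A conjunctive Linked Data query: a BQP `P`, a finite set `S` of seed identifiers, and a
reachability criterion `c`. -/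
structure CLDQuery (I L V : Type) [Denumerable I] [Denumerable L] [Denumerable V] where
  /-- the basic query pattern -/
  P : BQP I L V
  /-- the seed identifiers -/
  S : Finset I
  /-- the reachability criterion -/
  c : ReachabilityCriterion I L V

section Query

variable {I L V : Type} [Denumerable I] [Denumerable L] [Denumerable V]

/-- The documents that are `(c,P)`-reachable from `S` in `W`. -/
inductive CLDQuery.Reachable (q : CLDQuery I L V) (W : Web I L) : W.D → Prop
  | seed (u : I) (d : W.D) (hu : u ∈ q.S) (hd : W.adoc u = some d) : CLDQuery.Reachable q W d
  | link (d d' : W.D) (t : DataTriple I L) (u : I) (hd : CLDQuery.Reachable q W d)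
      (ht : t ∈ W.data d) (hu : t.HasId u) (hc : q.c.toFun t u q.P = true)
      (hd' : W.adoc u = some d') : CLDQuery.Reachable q W d'

/-- The `(S,c,P)`-reachable part of `W`. -/
noncomputable def CLDQuery.reachablePart (q : CLDQuery I L V) (W : Web I L) : Web I L :=
  W.inducedSubweb {d | q.Reachable W d}

/-- The result of the query over `W`: all valuations `μ` with `dom(μ) = vars(P)` and
`μ[P] ⊆ AllData` of the `(S,c,P)`-reachable part of `W`. -/
def CLDQuery.result (q : CLDQuery I L V) (W : Web I L) : Set (Valuation I L V) :=
  {μ | (∀ v : V, (μ v).isSome ↔ v ∈ BQP.vars q.P) ∧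
    ∀ tp ∈ q.P, ∃ t ∈ (q.reachablePart W).allData,
      μ.subst tp = some (Sum.inl t.1, Sum.inl t.2.1, t.2.2)}

end Query

/-! ## Encodings -/

/-- The symbols used by the encodings: binary digits, the brackets of triples, the brackets of sets
of triples and of valuations, the comma, the arrow, and the sharp sign. -/
inductive Sym : Type
  | bit (b : Bool) | tripleL | tripleR | setL | setR | comma | arrow | sharp
  deriving DecidableEq, Fintype

/-- Binary representation: the binary digits of `k + 1` (least significant digit first), where `k`
is the position of the element in the fixed enumeration of its type; never the empty word. -/
def encBin {α : Type} [Denumerable α] (a : α) : List Sym :=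
  (Nat.bits (Encodable.encode a + 1)).map Sym.bit

/-- The total order given by the fixed enumeration. -/
def codeLe {α : Type} [Denumerable α] (a b : α) : Prop := Encodable.encode a ≤ Encodable.encode b

instance {α : Type} [Denumerable α] : DecidableRel (codeLe (α := α)) :=
  fun a b => inferInstanceAs (Decidable (Encodable.encode a ≤ Encodable.encode b))

instance {α : Type} [Denumerable α] : IsTrans α codeLe :=
  ⟨fun _ _ _ h₁ h₂ => le_trans (α := ℕ) h₁ h₂⟩

instance {α : Type} [Denumerable α] : Std.Antisymm (codeLe (α := α)) :=
  ⟨fun _ _ h₁ h₂ => Encodable.encode_injective (le_antisymm (α := ℕ) h₁ h₂)⟩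

instance {α : Type} [Denumerable α] : Std.Total (codeLe (α := α)) :=
  ⟨fun a b => le_total (Encodable.encode a) (Encodable.encode b)⟩

/-- The elements of a finite set in increasing order. -/
def sorted {α : Type} [Denumerable α] (s : Finset α) : List α := s.sort codeLe

section Encoding

variable {I L V : Type} [Denumerable I] [Denumerable L] [Denumerable V]

/-- Encoding of an identifier or literal; identifiers and literals get different words. -/
def encTerm (x : I ⊕ L) : List Sym := encBin x

/-- Encoding of an identifier. -/
def encId (L : Type) [Denumerable L] (u : I) : List Sym := encTerm (Sum.inl u : I ⊕ L)

/-- Encoding of a data triple. -/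
def encTriple (t : DataTriple I L) : List Sym :=
  [Sym.tripleL] ++ encId L t.1 ++ [Sym.comma] ++ encId L t.2.1 ++ [Sym.comma] ++ encTerm t.2.2 ++
    [Sym.tripleR]

/-- Encoding of a finite set of data triples, in increasing order. -/
def encTriples (T : Finset (DataTriple I L)) : List Sym :=
  [Sym.setL] ++ [Sym.comma].intercalate ((sorted T).map encTriple) ++ [Sym.setR]

/-- Encoding of a document. -/
def Web.encDoc (W : Web I L) (d : W.D) : List Sym := encTriples (W.data d)

/-- The part of the encoding of `W` for the identifiers among the first `n` ones. -/
def Web.encPrefix (W : Web I L) (n : ℕ) : List Sym :=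
  [Sym.sharp] ++ (List.range n).flatMap fun k =>
    match W.adoc (Denumerable.ofNat I k) with
    | none => []
    | some d => encId L (Denumerable.ofNat I k) ++ W.encDoc d ++ [Sym.sharp]

/-- The content of a right-infinite tape over `Sym`; `none` is the blank. -/
abbrev SymTape : Type := ℕ → Option Sym

open Classical in
/-- The encoding of `W`, as the content of the Web tape: the possibly infinite word
`♯ enc(u₁) enc(adoc u₁) ♯ enc(u₂) enc(adoc u₂) ♯ ...` that is the limit of the words
`W.encPrefix n`. -/
noncomputable def Web.enc (W : Web I L) : SymTape := fun i =>
  if h : ∃ s : Sym, ∃ n : ℕ, (W.encPrefix n)[i]? = some s then some h.choose else none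

/-- Encoding of a valuation with domain `X`, in increasing order of the variables. -/
def encValuation (X : Finset V) (μ : Valuation I L V) : List Sym :=
  [Sym.setL] ++
    [Sym.comma].intercalate ((sorted X).map fun v =>
      encBin v ++ [Sym.arrow] ++ ((μ v).map encTerm).getD []) ++
    [Sym.setR]

/-- `w` is a possible encoding of the set `Ω` of valuations with domain `X`: the concatenation of
the encodings of the elements of `Ω`, each one once, in any order. -/
def IsEncoding (X : Finset V) (Ω : Set (Valuation I L V)) (w : List Sym) : Prop :=
  ∃ l : List (Valuation I L V), l.Nodup ∧ (∀ μ, μ ∈ l ↔ μ ∈ Ω) ∧ w = l.flatMap (encValuation X)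

end Encoding

/-! ## LD machines -/

/-- The symbols on the two work tapes: `none` is the blank; besides the encoding symbols a machine
has a finite set `A` of further tape symbols. -/
abbrev TapeSym (A : Type) : Type := Option (Sym ⊕ A)

/-- What a machine does in one ordinary step. A head moves left or right, or stays (`none`). -/
structure Action (Q A : Type) where
  /-- the next state -/
  next : Q
  /-- move on the ordinary input tape -/
  inputMove : Option Turing.Dir
  /-- symbol written on the ordinary work tape -/
  workWrite : TapeSym A
  /-- move on the ordinary work tape -/
  workMove : Option Turing.Dir
  /-- symbol written on the link traversal tape -/
  linkWrite : TapeSym A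
  /-- move on the link traversal tape -/
  linkMove : Option Turing.Dir
  /-- symbol appended to the output tape, if any -/
  output : Option Sym

/-- An LD machine: a deterministic Turing machine with an ordinary read-only input tape, a Web tape,
a two-way infinite work tape, a right-infinite link traversal tape, an append-only output tape,
finitely many states, and a special expand state. The transition function depends on the state and
on the symbols scanned on the input tape, the work tape and the link traversal tape; the machine
halts where it is `none`. -/
structure LDMachine where
  /-- the states -/
  Q : Type
  finite_Q : Finite Q
  /-- the tape symbols of the machine other than the blank and the encoding symbols -/
  A : Type
  finite_A : Finite A
  /-- the initial state -/
  start : Q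
  /-- the expand state -/
  expand : Q
  /-- the transition function -/
  δ : Q → Option Sym → TapeSym A → TapeSym A → Option (Action Q A)

/-- A configuration of an LD machine (without its two input tapes, which do not change). -/
structure Config (Q A : Type) where
  /-- the state -/
  state : Q
  /-- head position on the ordinary input tape -/
  inputPos : ℕ
  /-- the ordinary work tape with its head -/
  work : Turing.Tape (TapeSym A)
  /-- the content of the link traversal tape -/
  link : ℕ → TapeSym A
  /-- head position on the link traversal tape -/
  linkPos : ℕ
  /-- the word on the output tape -/
  out : List Sym

/-- Head movement on a right-infinite tape; a left move in the first cell has no effect. -/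
def movePos : Option Turing.Dir → ℕ → ℕ
  | none, n => n
  | some Turing.Dir.left, n => n - 1
  | some Turing.Dir.right, n => n + 1

/-- Head movement on a two-way infinite tape. -/
def moveTape {Γ : Type} [Inhabited Γ] : Option Turing.Dir → Turing.Tape Γ → Turing.Tape Γ
  | none, T => T
  | some d, T => T.move d

/-- The length of the word on a right-infinite tape, i.e. up to the last non-blank cell. -/
noncomputable def wordLength {B : Type} (t : ℕ → Option B) : ℕ :=
  sInf {n | ∀ m, n ≤ m → t m = none}

/-- The word on a right-infinite tape. -/
noncomputable def tapeWord {B : Type} (t : ℕ → Option B) : List (Option B) :=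
  (List.range (wordLength t)).map t

/-- Append a word at the right end of the word on a right-infinite tape. -/
noncomputable def appendWord {B : Type} (t : ℕ → Option B) (x : List B) : ℕ → Option B := fun i =>
  if i < wordLength t then t i else x[i - wordLength t]?

/-- The tape contains the word `x` (in consecutive cells). -/
def SymTape.Contains (web : SymTape) (x : List Sym) : Prop :=
  ∃ i : ℕ, ∀ (j : ℕ) (hj : j < x.length), web (i + j) = some x[j]

/-- The word `w` ends with the binary word `x`, and `x` is the maximal suffix of binary digits. -/
def HasBinarySuffix {A : Type} (w : List (TapeSym A)) (x : List Sym) : Prop :=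
  ∃ pre : List (TapeSym A), w = pre ++ x.map (fun s => some (Sum.inl s)) ∧
    ∀ b : Bool, pre.getLast? ≠ some (some (Sum.inl (Sym.bit b)))

section Machine

variable (I L : Type) [Denumerable I] [Denumerable L]

/-- The binary suffix of `w` is the encoding of an identifier `u`, and the Web tape contains
`♯ enc(u) x ♯` where `x` encodes the data of a document. -/
def IsLookup {A : Type} (web : SymTape) (w : List (TapeSym A)) (x : List Sym) : Prop :=
  ∃ (u : I) (T : Finset (DataTriple I L)), HasBinarySuffix w (encId L u) ∧ x = encTriples T ∧
    web.Contains ([Sym.sharp] ++ encId L u ++ x ++ [Sym.sharp])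

open Classical in
/-- The word that the expand procedure appends to the word `w` on the link traversal tape. -/
noncomputable def expandWord {A : Type} (web : SymTape) (w : List (TapeSym A)) : List Sym :=
  (if h : ∃ x, IsLookup I L web w x then h.choose else []) ++ [Sym.sharp]

/-- The expand procedure; it does not move the heads. -/
noncomputable def Config.expand {Q A : Type} (web : SymTape) (κ : Config Q A) : Config Q A :=
  { κ with link :=
      appendWord κ.link ((expandWord I L web (tapeWord κ.link)).map Sum.inl) }

open Classical in
/-- One step of an LD machine. In the expand state the machine first performs the expand procedure;
then, as in every other state, it makes the step given by its transition function. The step is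
`none` if the machine halts. -/
noncomputable def LDMachine.step (M : LDMachine) (web : SymTape) (input : List Sym)
    (κ₀ : Config M.Q M.A) : Option (Config M.Q M.A) :=
  let κ := if κ₀.state = M.expand then κ₀.expand I L web else κ₀
  (M.δ κ.state input[κ.inputPos]? κ.work.head (κ.link κ.linkPos)).map fun a =>
    { state := a.next
      inputPos := movePos a.inputMove κ.inputPos
      work := moveTape a.workMove (κ.work.write a.workWrite)
      link := Function.update κ.link κ.linkPos a.linkWrite
      linkPos := movePos a.linkMove κ.linkPos
      out := κ.out ++ a.output.toList }

/-- The initial configuration: the work tapes and the output tape are empty. -/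
def LDMachine.init (M : LDMachine) : Config M.Q M.A where
  state := M.start
  inputPos := 0
  work := default
  link := fun _ => none
  linkPos := 0
  out := []

/-- With the given contents of the Web tape and of the ordinary input tape, the machine halts after
finitely many steps with the word `out` on its output tape. -/
def LDMachine.HaltsWith (M : LDMachine) (web : SymTape) (input out : List Sym) : Prop :=
  ∃ κ : Config M.Q M.A, StateTransition.Reaches (M.step I L web input) M.init κ ∧
    M.step I L web input κ = none ∧ κ.out = out

end Machine

section Computation

variable {I L V : Type} [Denumerable I] [Denumerable L] [Denumerable V]

/-- With `enc(W)` on its Web tape (and an empty ordinary input tape), the machine halts after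
finitely many steps. -/
def LDMachine.HaltsOn (M : LDMachine) (W : Web I L) : Prop :=
  ∃ out : List Sym, M.HaltsWith I L W.enc [] out

/-- The machine computes the results of the query: whatever Web of Linked Data is encoded on its Web
tape, if the machine halts, then its output is a possible encoding of the complete query result over
that Web. -/
def LDMachine.Computes (M : LDMachine) (q : CLDQuery I L V) : Prop :=
  ∀ (W : Web I L) (out : List Sym), M.HaltsWith I L W.enc [] out →
    IsEncoding (BQP.vars q.P) (q.result W) out

end Computation

end LinkedData

/-! The existence half is link traversal. Keep a list of the triples retrieved so far, and
repeatedly look up an identifier that is a seed or is licensed by the criterion through a known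
triple, and that has not been looked up before. When no such identifier is left, the known triples
are exactly the data of the reachable part (`CLDQuery.mem_iff_mem_allData`), so the result can be
evaluated over a finite list and printed (`CLDQuery.isEncoding_resultWord`). The identifiers looked
up are distinct and come from a set that is finite if the reachable part is, which gives
`CLDQuery.IsCode.haltsOn`. The machine stops only after printing the result, which gives
`CLDQuery.IsCode.computes` on every Web, finite or not.

To make this an actual machine, control is separated from computation. `Driver.machine c` works in
rounds: it passes the unread part of the link traversal tape and a number (its memory) to the code
`c`, receives a single number that packs a command with the new memory, and executes the command.
The evaluation takes place on the work tape, through the translations from `ToPartrec.Code` to stack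
programs and to one-tape Turing machines. What remains is a number format that finite control can
read and write symbol by symbol (`Driver.leads_round`), the partial recursiveness of the traversal
program (`CLDQuery.partrec_program`), and the fact that the expand procedure returns the right
document, which rests on unique readability of `enc(W)` (`isLookup_enc_iff`).

The converse is an adversary argument (`LDMachine.Computes.reachablePart_isFinite`). A halting run
inspects finitely many documents. If infinitely many are reachable, some reachable document is never
inspected, and adding triples to it changes neither the run nor the output. Since there is a
variable, the added triples can be chosen to produce a new solution, while all old solutions
persist. But an output word determines how many valuations it encodes, so the same word cannot
encode both results. -/

namespace LinkedData

open Turing StateTransition Relation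

/-! ## A stack program for partial recursive functions with callable pushes and pops -/

namespace Driver

open PartrecToTM2

/-- The alphabet of a stack. -/
abbrev Bin : Type := PartrecToTM2.Γ'

/-- Labels of the stack program: those of the evaluator of `ToPartrec.Code`, a pop and pushes on
the main stack. -/
abbrev Label : Type := PartrecToTM2.Λ' ⊕ Option Bin

instance : Inhabited Label := ⟨Sum.inl (PartrecToTM2.Λ'.ret Cont'.halt)⟩

/-- Statements of the stack program. -/
abbrev Stmt : Type := TM2.Stmt (fun _ : K' => Bin) Label (Option Bin)

/-- Relabel a statement of the evaluator. -/
def liftStmt : TM2.Stmt (fun _ : K' => Bin) PartrecToTM2.Λ' (Option Bin) → Stmt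
  | .push k f q => .push k f (liftStmt q)
  | .peek k f q => .peek k f (liftStmt q)
  | .pop k f q => .pop k f (liftStmt q)
  | .load a q => .load a (liftStmt q)
  | .branch p q₁ q₂ => .branch p (liftStmt q₁) (liftStmt q₂)
  | .goto l => .goto fun v => Sum.inl (l v)
  | .halt => .halt

/-- The stack program. -/
def prog : Label → Stmt
  | Sum.inl l => liftStmt (PartrecToTM2.tr l)
  | Sum.inr none => .pop K'.main (fun _ x => x) .halt
  | Sum.inr (some g) => .push K'.main (fun _ => g) .halt

/-- Relabel a configuration of the evaluator. -/
def liftCfg (c : TM2.Cfg (fun _ : K' => Bin) PartrecToTM2.Λ' (Option Bin)) :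
    TM2.Cfg (fun _ : K' => Bin) Label (Option Bin) :=
  ⟨c.l.map Sum.inl, c.var, c.stk⟩

theorem stepAux_liftStmt (q : TM2.Stmt (fun _ : K' => Bin) PartrecToTM2.Λ' (Option Bin))
    (v : Option Bin) (S : K' → List Bin) :
    TM2.stepAux (liftStmt q) v S = liftCfg (TM2.stepAux q v S) := by
  induction q generalizing v S with
  | branch p q₁ q₂ h₁ h₂ => cases h : p v <;> simp [liftStmt, h, h₁, h₂]
  | goto l => simp [liftStmt, liftCfg]
  | halt => simp [liftStmt, liftCfg]
  | _ => simp [liftStmt, *]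

theorem reaches_liftCfg {a b : TM2.Cfg (fun _ : K' => Bin) PartrecToTM2.Λ' (Option Bin)}
    (h : Reaches (TM2.step PartrecToTM2.tr) a b) :
    Reaches (TM2.step prog) (liftCfg a) (liftCfg b) := by
  refine ReflTransGen.lift (r := fun a b => b ∈ TM2.step PartrecToTM2.tr a) liftCfg
    (fun a b hab => ?_) _ _ h
  obtain ⟨_ | l, v, S⟩ := a
  · cases hab
  · change liftCfg b ∈ TM2.step prog (liftCfg _)
    change some _ = some b at hab
    simp only [Option.some.injEq] at hab
    subst hab
    exact congrArg some (stepAux_liftStmt _ v S)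

/-- Evaluation starts and ends with only the main stack in use, so its end state can serve directly
as the start of a push, a pop or another evaluation. -/
theorem reaches_eval {c : ToPartrec.Code} {v w : List ℕ} (h : w ∈ c.eval v) :
    Reaches (TM2.step prog)
      ⟨some (Sum.inl (trNormal c Cont'.halt)), none, K'.elim (trList v) [] [] []⟩
      ⟨none, none, K'.elim (trList w) [] [] []⟩ := by
  have h' : PartrecToTM2.halt w ∈ eval (TM2.step PartrecToTM2.tr) (PartrecToTM2.init c v) := by
    rw [PartrecToTM2.tr_eval]
    exact Part.mem_map _ h
  exact reaches_liftCfg (mem_eval.1 h').1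

theorem reaches_pop (v : Option Bin) (l : List Bin) :
    Reaches (TM2.step prog) ⟨some (Sum.inr none), v, K'.elim l [] [] []⟩
      ⟨none, l.head?, K'.elim l.tail [] [] []⟩ :=
  ReflTransGen.single (by simp [prog])

theorem reaches_push (g : Bin) (v : Option Bin) (l : List Bin) :
    Reaches (TM2.step prog) ⟨some (Sum.inr (some g)), v, K'.elim l [] [] []⟩
      ⟨none, v, K'.elim (g :: l) [] [] []⟩ :=
  ReflTransGen.single (by simp [prog])

open Classical in
/-- The labels that are used for evaluating `c`. -/
noncomputable def labels (c : ToPartrec.Code) : Finset Label :=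
  (insert (PartrecToTM2.Λ'.ret Cont'.halt) (codeSupp c Cont'.halt)).image Sum.inl ∪
    Finset.univ.image Sum.inr

theorem supportsStmt_liftStmt {S : Finset PartrecToTM2.Λ'} {S' : Finset Label}
    (hS : ∀ l ∈ S, Sum.inl l ∈ S')
    (q : TM2.Stmt (fun _ : K' => Bin) PartrecToTM2.Λ' (Option Bin)) (h : TM2.SupportsStmt S q) :
    TM2.SupportsStmt S' (liftStmt q) := by
  induction q with
  | branch p q₁ q₂ h₁ h₂ => exact ⟨h₁ h.1, h₂ h.2⟩
  | goto l => exact fun v => hS _ (h v)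
  | halt => trivial
  | push k f q ih => exact ih h
  | peek k f q ih => exact ih h
  | pop k f q ih => exact ih h
  | load a q ih => exact ih h

theorem supports_labels (c : ToPartrec.Code) : TM2.Supports prog (labels c) := by
  refine ⟨?_, fun l hl => ?_⟩
  -- Support requires the default label too; this is why `labels` inserts `ret halt` by hand. Its
  -- statement jumps nowhere, so nothing else has to be added.
  · have : (default : Label) = Sum.inl (PartrecToTM2.Λ'.ret Cont'.halt) := rfl
    simp [labels, this]
  · rcases l with l | _ | g
    · have hsub : ∀ l ∈ codeSupp c Cont'.halt, (Sum.inl l : Label) ∈ labels c := fun l hl => by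
        simp [labels, hl]
      simp only [labels, Finset.mem_union, Finset.mem_image, Finset.mem_insert] at hl
      obtain ⟨l', h | h, h'⟩ | ⟨l', -, h'⟩ := hl
      · cases h'
        subst h
        trivial
      · cases h'
        exact supportsStmt_liftStmt hsub _
          ((PartrecToTM2.tr_supports c Cont'.halt).2 _ h)
      · cases h'
    · trivial
    · trivial

theorem inr_mem_labels (c : ToPartrec.Code) (o : Option Bin) : (Sum.inr o : Label) ∈ labels c := by
  simp [labels]

theorem trNormal_mem_labels (c : ToPartrec.Code) :
    (Sum.inl (trNormal c Cont'.halt) : Label) ∈ labels c := by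
  have := (PartrecToTM2.tr_supports c Cont'.halt).1
  exact Finset.mem_union_left _ (Finset.mem_image_of_mem _ (Finset.mem_insert_of_mem this))

/-! ## The stack program on one tape -/

/-- The tape alphabet of the one-tape version of the stack program. -/
abbrev Cell : Type := TM2to1.Γ' K' (fun _ => Bin)

/-- The one-tape version of the stack program. -/
abbrev prog₁ : TM2to1.Λ' K' (fun _ => Bin) Label (Option Bin) →
    TM1.Stmt Cell (TM2to1.Λ' K' (fun _ => Bin) Label (Option Bin)) (Option Bin) :=
  TM2to1.tr prog

/-- The one-tape version of the stack program as a Turing machine. -/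
abbrev prog₀ : TM0.Machine Cell (TM1to0.Λ' prog₁) := TM1to0.tr prog₁

/-- The states of the Turing machine that are used for evaluating `c`. -/
noncomputable def states (c : ToPartrec.Code) : Finset (TM1to0.Λ' prog₁) :=
  TM1to0.trStmts prog₁ (TM2to1.trSupp prog (labels c))

theorem supports_states (c : ToPartrec.Code) : TM0.Supports prog₀ (states c : Set _) :=
  TM1to0.tr_supports _ (TM2to1.tr_supports _ (supports_labels c))

theorem halted_mem_states (c : ToPartrec.Code) (v : Option Bin) :
    ((none, v) : TM1to0.Λ' prog₁) ∈ states c := by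
  simp only [states, TM1to0.trStmts]
  refine Finset.mem_product.2 ⟨?_, Finset.mem_univ _⟩
  simp [TM1.stmts]

theorem start_mem_states {c : ToPartrec.Code} {l : Label} (hl : l ∈ labels c) (v : Option Bin) :
    ((some (prog₁ (TM2to1.Λ'.normal l)), v) : TM1to0.Λ' prog₁) ∈ states c := by
  simp only [states, TM1to0.trStmts]
  refine Finset.mem_product.2 ⟨?_, Finset.mem_univ _⟩
  simp only [TM1.stmts]
  classical
  refine Finset.some_mem_insertNone.2 (Finset.mem_biUnion.2 ⟨_, ?_, TM1.stmts₁_self⟩)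
  exact Finset.mem_biUnion.2 ⟨l, hl, Finset.mem_insert_self _ _⟩

/-- The tape holds the main stack `l`, the other stacks being empty. -/
def Holds (T : Tape Cell) (l : List Bin) : Prop :=
  ∃ L : ListBlank (K' → Option Bin),
    (∀ k, L.map (proj k) = ListBlank.mk ((K'.elim l [] [] [] k).map some).reverse) ∧
      T = Tape.mk' ∅ (TM2to1.addBottom L)

/-- Composes the simulation of stacks by one tape with the passage from statements to single steps.
Both end with the head back at the bottom marker, so calls can be chained. -/
theorem reaches_prog₀ {l : Label} {v v' : Option Bin} {s s' : List Bin} {T : Tape Cell}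
    (h : Reaches (TM2.step prog) ⟨some l, v, K'.elim s [] [] []⟩ ⟨none, v', K'.elim s' [] [] []⟩)
    (hT : Holds T s) :
    ∃ T', Holds T' s' ∧
      Reaches (TM0.step prog₀) ⟨(some (prog₁ (TM2to1.Λ'.normal l)), v), T⟩ ⟨(none, v'), T'⟩ := by
  obtain ⟨L, hL, rfl⟩ := hT
  obtain ⟨c₁, h₁, h₂⟩ := tr_reaches (TM2to1.tr_respects prog) (TM2to1.TrCfg.mk L hL) h
  obtain ⟨c₀, rfl, h₄⟩ := tr_reaches (TM1to0.tr_respects prog₁) rfl h₂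
  obtain ⟨L', hL'⟩ := h₁
  exact ⟨_, ⟨L', hL', rfl⟩, h₄⟩

end Driver

end LinkedData


namespace LinkedData

open Turing StateTransition Relation

/-! ## Words on right-infinite tapes -/

/-- The right-infinite tape that contains the word `w`. -/
def tapeOf {B : Type} (w : List B) : ℕ → Option B := fun i => w[i]?

theorem wordLength_tapeOf {B : Type} (w : List B) : wordLength (tapeOf w) = w.length := by
  have h : {n | ∀ m, n ≤ m → tapeOf w m = none} = Set.Ici w.length := by
    ext n
    simp only [tapeOf, List.getElem?_eq_none_iff, Set.mem_ofPred_eq, Set.mem_Ici]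
    exact ⟨fun h => h n le_rfl, fun h m hm => h.trans hm⟩
  rw [wordLength, h, csInf_Ici]

theorem tapeWord_tapeOf {B : Type} (w : List B) : tapeWord (tapeOf w) = w.map some := by
  rw [tapeWord, wordLength_tapeOf]
  refine List.ext_getElem (by simp) fun i h₁ h₂ => ?_
  simp at h₁
  simp [tapeOf, h₁]

theorem appendWord_tapeOf {B : Type} (w x : List B) :
    appendWord (tapeOf w) x = tapeOf (w ++ x) := by
  funext i
  simp only [appendWord, wordLength_tapeOf, tapeOf]
  split_ifs with h
  · rw [List.getElem?_append_left h]
  · rw [List.getElem?_append_right (not_lt.1 h)]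

theorem update_tapeOf {B : Type} (w : List B) (b : B) :
    Function.update (tapeOf w) w.length (some b) = tapeOf (w ++ [b]) := by
  funext i
  by_cases h : i = w.length
  · subst h
    simp [tapeOf]
  · rw [Function.update_of_ne h]
    rcases lt_or_gt_of_ne h with h | h
    · simp [tapeOf, List.getElem?_append_left h]
    · simp only [tapeOf]
      rw [List.getElem?_eq_none h.le, List.getElem?_eq_none (by simp; omega)]

/-! ## Steps of LD machines -/

/-- The effect of an ordinary step. -/
def Config.apply {Q A : Type} (κ : Config Q A) (a : Action Q A) : Config Q A where
  state := a.next
  inputPos := movePos a.inputMove κ.inputPos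
  work := moveTape a.workMove (κ.work.write a.workWrite)
  link := Function.update κ.link κ.linkPos a.linkWrite
  linkPos := movePos a.linkMove κ.linkPos
  out := κ.out ++ a.output.toList

section Step

variable {I L : Type} [Denumerable I] [Denumerable L] (M : LDMachine) (web : SymTape)
  (input : List Sym)

theorem LDMachine.step_of_ne {κ : Config M.Q M.A} (h : κ.state ≠ M.expand) :
    M.step I L web input κ =
      (M.δ κ.state input[κ.inputPos]? κ.work.head (κ.link κ.linkPos)).map κ.apply := by
  rw [LDMachine.step, if_neg h]
  rfl

theorem LDMachine.step_of_eq {κ : Config M.Q M.A} (h : κ.state = M.expand) :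
    M.step I L web input κ =
      (M.δ κ.state input[κ.inputPos]? κ.work.head ((κ.expand I L web).link κ.linkPos)).map
        (κ.expand I L web).apply := by
  rw [LDMachine.step, if_pos h]
  rfl

end Step

/-! ## The driver machine -/

/-- A numbering of the encoding symbols. -/
def Sym.code : Sym → ℕ
  | bit false => 0
  | bit true => 1
  | tripleL => 2
  | tripleR => 3
  | setL => 4
  | setR => 5
  | comma => 6
  | arrow => 7
  | sharp => 8

theorem Sym.code_lt (s : Sym) : s.code < 9 := by
  rcases s with (_ | _) | _ | _ | _ | _ | _ | _ | _ <;> decide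

theorem Sym.code_injective : Function.Injective Sym.code := by
  intro a b
  revert a b
  decide

/-- Commands of a program that controls an LD machine: append a symbol to the output tape or to the
link traversal tape, expand, and halt. -/
inductive Cmd : Type
  | emit (s : Sym) | write (s : Sym) | expand | halt
  deriving DecidableEq, Fintype

instance : Inhabited Cmd := ⟨Cmd.halt⟩

/-- A numbering of the commands. -/
def Cmd.code : Cmd → ℕ
  | emit s => s.code
  | write s => 9 + s.code
  | expand => 18
  | halt => 19

theorem Cmd.code_lt (a : Cmd) : a.code < 32 := by
  rcases a with s | s | _ | _ <;> simp [Cmd.code]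
  all_goals have := s.code_lt; omega

theorem Cmd.code_injective : Function.Injective Cmd.code := by
  rintro (a | a | _ | _) (b | b | _ | _) h <;> simp only [Cmd.code] at h <;>
    (try have ha := Sym.code_lt a) <;> (try have hb := Sym.code_lt b) <;>
    first
    | rfl
    | omega
    | rw [Sym.code_injective h]
    | rw [Sym.code_injective (Nat.add_left_cancel h)]

/-- The command with a given number. -/
noncomputable def cmdOf : ℕ → Cmd := Function.invFun Cmd.code

theorem cmdOf_code (a : Cmd) : cmdOf a.code = a :=
  Function.leftInverse_invFun Cmd.code_injective a

namespace Driver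

open PartrecToTM2

/-- What the driver machine is doing. -/
inductive Mode : Type
  | init | sep | one | read | pushing (k : Fin 32) | pop (k : Fin 32) | popped (k : Fin 32)
  deriving Fintype

/-- The states of the driver machine: writing the bottom marker of the stacks, the expand state, and
running the stack program. -/
inductive State (c : ToPartrec.Code) : Type
  | boot | expand | run (m : Mode) (q : states c)

instance (c : ToPartrec.Code) : Finite (State c) := by
  refine Finite.of_injective
    (fun s : State c => match s with
      | .boot => (Sum.inl true : Bool ⊕ Mode × states c)
      | .expand => Sum.inl false
      | .run m q => Sum.inr (m, q)) ?_
  rintro (_ | _ | _) (_ | _ | _) h <;> simp_all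

/-- The state in which the stack program has halted with the variable `v`. -/
noncomputable def halted {c : ToPartrec.Code} (v : Option Bin) : states c :=
  ⟨(none, v), halted_mem_states c v⟩

/-- The state in which the stack program is started at label `l`. -/
noncomputable def call {c : ToPartrec.Code} (l : Label) (hl : l ∈ labels c) : states c :=
  ⟨(some (prog₁ (TM2to1.Λ'.normal l)), none), start_mem_states hl none⟩

/-- Pop a symbol. -/
noncomputable def callPop {c : ToPartrec.Code} : states c :=
  call (Sum.inr none) (inr_mem_labels c _)

/-- Push a symbol. -/
noncomputable def callPush {c : ToPartrec.Code} (g : Bin) : states c :=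
  call (Sum.inr (some g)) (inr_mem_labels c _)

/-- Evaluate `c`. -/
noncomputable def callCode {c : ToPartrec.Code} : states c := call _ (trNormal_mem_labels c)

instance : Finite Cell := by
  have : Finite K' := Finite.of_surjective
    (fun i : Fin 4 => ([K'.main, K'.rev, K'.aux, K'.stack][i] : K')) fun k => by
      cases k
      exacts [⟨0, rfl⟩, ⟨1, rfl⟩, ⟨2, rfl⟩, ⟨3, rfl⟩]
  exact inferInstanceAs (Finite (Bool × (K' → Option Bin)))

open Classical in
/-- The blank of the stack program becomes the blank of the driver machine. -/
noncomputable def toSym : PointedMap Cell (TapeSym Cell) where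
  f a := if a = default then none else some (Sum.inr a)
  map_pt' := if_pos rfl

/-- The cell of the stack program represented by a tape symbol. -/
def ofSym : TapeSym Cell → Cell
  | some (Sum.inr a) => a
  | _ => default

open Classical in
theorem ofSym_toSym (a : Cell) : ofSym (toSym a) = a := by
  change ofSym (if a = default then none else some (Sum.inr a)) = a
  split_ifs with h
  · exact h.symm
  · rfl

/-- An action that does not touch the tapes. -/
def idleAction {c : ToPartrec.Code} (w l : TapeSym Cell) (q : State c) : Action (State c) Cell where
  next := q
  inputMove := none
  workWrite := w
  workMove := none
  linkWrite := l
  linkMove := none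
  output := none

/-- The action of the driver machine when the stack program has halted in mode `popped k` after
popping a symbol other than `bit0`. -/
noncomputable def execute {c : ToPartrec.Code} (w l : TapeSym Cell) : Cmd →
    Option (Action (State c) Cell)
  | .emit s => some { idleAction w l (.run .sep (halted none)) with output := some s }
  | .write s => some { idleAction w l (.run .sep (halted none)) with
      linkWrite := some (Sum.inl s), linkMove := some Dir.right }
  | .expand => some (idleAction w l .expand)
  | .halt => none

/-- The action of the driver machine when the stack program has halted with the variable `v`. -/
noncomputable def dispatch {c : ToPartrec.Code} (w l : TapeSym Cell) (v : Option Bin) : Mode →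
    Option (Action (State c) Cell)
  | .init => some (idleAction w l (.run .sep (callPush Γ'.cons)))
  | .sep => some (idleAction w l (.run .one (callPush Γ'.cons)))
  | .one => some (idleAction w l (.run .read (callPush Γ'.bit1)))
  | .read => match l with
    | some (Sum.inl s) =>
      some { idleAction w l (.run (.pushing (Fin.ofNat 32 s.code)) (halted none)) with
        linkMove := some Dir.right }
    | _ => some (idleAction w l (.run (.pop 0) callCode))
  | .pushing k =>
    if k = 0 then some (idleAction w l (.run .read (callPush Γ'.bit1)))
    else some (idleAction w l (.run (.pushing (k - 1)) (callPush Γ'.bit0)))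
  | .pop k => some (idleAction w l (.run (.popped k) callPop))
  | .popped k =>
    if v = some Γ'.bit0 then some (idleAction w l (.run (.pop (k + 1)) (halted none)))
    else execute w l (cmdOf k)

/-- The action of the driver machine while the stack program is running. -/
noncomputable def perform {c : ToPartrec.Code} (w l : TapeSym Cell) (m : Mode) (q : states c) :
    TM0.Stmt Cell → Action (State c) Cell
  | .move d => { idleAction w l (.run m q) with workMove := some d }
  | .write a => { idleAction w l (.run m q) with workWrite := toSym a }

/-- The LD machine that is controlled by the code `c`. -/
noncomputable def machine (c : ToPartrec.Code) : LDMachine where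
  Q := State c
  finite_Q := inferInstance
  A := Cell
  finite_A := inferInstanceAs (Finite Cell)
  start := .boot
  expand := .expand
  δ
    | .boot, _, _, l => some (idleAction (toSym (true, fun _ => none)) l (.run .init (halted none)))
    | .expand, _, w, l => some (idleAction w l (.run .sep (halted none)))
    | .run m q, _, w, l =>
      match h : prog₀ q.1 (ofSym w) with
      | none => dispatch w l q.1.2 m
      | some (q', s) => some (perform w l m ⟨q', (supports_states c).2 h q.2⟩ s)

/-! ### Runs of the driver machine and their composition into rounds -/

section Run

variable (I L : Type) [Denumerable I] [Denumerable L] {c : ToPartrec.Code}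

/-- A configuration of the driver machine with the word `w` on the link traversal tape. -/
noncomputable def config (m : Mode) (q : states c) (T : Tape Cell) (w : List Sym) (pos : ℕ)
    (out : List Sym) : Config (State c) Cell where
  state := State.run m q
  inputPos := 0
  work := T.map toSym
  link := tapeOf (w.map Sum.inl)
  linkPos := pos
  out := out

/-- The steps of the driver machine. -/
noncomputable abbrev next (c : ToPartrec.Code) (web : SymTape) :
    Config (State c) Cell → Option (Config (State c) Cell) :=
  (machine c).step I L web []

theorem next_config (web : SymTape) (m : Mode) (q : states c) (T : Tape Cell) (w : List Sym)
    (pos : ℕ) (out : List Sym) :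
    next I L c web (config m q T w pos out) =
      ((machine c).δ (State.run m q) none (toSym T.head) (tapeOf (w.map Sum.inl) pos)).map
        (config m q T w pos out).apply := by
  have hne : (config m q T w pos out).state ≠ (machine c).expand := by
    intro h
    cases h
  refine ((machine c).step_of_ne web [] hne).trans ?_
  rw [← Tape.map_fst]
  rfl

/-- The work tape is the image of the simulated tape under `toSym`, which `ofSym` inverts; hence the
driver sees the same symbol and makes the same move, and the supported set of states keeps it within
finitely many states. -/
theorem next_config_of_step (web : SymTape) (m : Mode) {q : states c} {T : Tape Cell}
    (w : List Sym) (pos : ℕ) (out : List Sym) {q' : TM1to0.Λ' prog₁} {T' : Tape Cell}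
    (h : (⟨q', T'⟩ : TM0.Cfg Cell _) ∈ TM0.step prog₀ ⟨q, T⟩) :
    ∃ hq : q' ∈ states c, config m ⟨q', hq⟩ T' w pos out ∈
      next I L c web (config m q T w pos out) := by
  obtain ⟨⟨q₁, s⟩, h₁, h₂⟩ := Option.map_eq_some_iff.1 h
  simp only [TM0.Cfg.mk.injEq] at h₂
  obtain ⟨rfl, rfl⟩ := h₂
  refine ⟨(supports_states c).2 h₁ q.2, ?_⟩
  have hδ : (machine c).δ (State.run m q) none (toSym T.head) (tapeOf (w.map Sum.inl) pos) =
      some (perform (toSym T.head) (tapeOf (w.map Sum.inl) pos) m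
        ⟨q₁, (supports_states c).2 h₁ q.2⟩ s) := by
    simp only [machine]
    split
    · rename_i h'
      rw [ofSym_toSym, h₁] at h'
      cases h'
    · rename_i h'
      rw [ofSym_toSym, h₁] at h'
      cases h'
      rfl
  rw [next_config, hδ]
  refine congrArg some ?_
  cases s with
  | move d =>
    simp [Config.apply, perform, idleAction, config, movePos, moveTape, Tape.map_move,
      ← Tape.map_fst, Tape.write_self]
  | write a =>
    simp [Config.apply, perform, idleAction, config, movePos, moveTape, Tape.map_write]

theorem next_config_halted (web : SymTape) (m : Mode) (v : Option Bin) (T : Tape Cell)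
    (w : List Sym) (pos : ℕ) (out : List Sym) :
    next I L c web (config m (halted v) T w pos out) =
      (dispatch (toSym T.head) (tapeOf (w.map Sum.inl) pos) v m).map
        (config m (halted v) T w pos out).apply := by
  rw [next_config]
  congr 1

theorem reaches_config (web : SymTape) (m : Mode) {q : states c} {T : Tape Cell}
    (w : List Sym) (pos : ℕ) (out : List Sym) {q' : states c} {T' : Tape Cell}
    (h : Reaches (TM0.step prog₀) (⟨q.1, T⟩ : TM0.Cfg Cell _) ⟨q'.1, T'⟩) :
    Reaches (next I L c web) (config m q T w pos out) (config m q' T' w pos out) := by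
  -- The intermediate states are not known in advance to lie in `states c`, so membership is carried
  -- through the induction.
  suffices H : ∀ C : TM0.Cfg Cell (TM1to0.Λ' prog₁), Reaches (TM0.step prog₀) ⟨q, T⟩ C →
      ∃ hq : C.q ∈ states c, Reaches (next I L c web) (config m q T w pos out)
        (config m ⟨C.q, hq⟩ C.Tape w pos out) from (H _ h).2
  intro C hC
  induction hC with
  | refl => exact ⟨q.2, ReflTransGen.refl⟩
  | tail h₁ h₂ ih =>
    obtain ⟨hq, ih⟩ := ih
    obtain ⟨hq', h'⟩ := next_config_of_step I L web m (q := ⟨_, hq⟩) w pos out h₂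
    exact ⟨hq', ih.tail h'⟩

/-- The configurations in which the stack program has halted with the variable `v` and with the main
stack `l`. -/
def idle (c : ToPartrec.Code) (m : Mode) (v : Option Bin) (l : List Bin) (w : List Sym) (pos : ℕ)
    (out : List Sym) : Set (Config (State c) Cell) :=
  {κ | ∃ T, Holds T l ∧ κ = config m (halted v) T w pos out}

/-- From each configuration of `A`, the driver machine reaches a configuration of `B` in at least
one step. -/
def Leads (c : ToPartrec.Code) (web : SymTape) (A B : Set (Config (State c) Cell)) : Prop :=
  ∀ κ ∈ A, ∃ κ' ∈ B, Reaches₁ (next I L c web) κ κ'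

variable {I L}

theorem Leads.trans {web : SymTape} {A B C : Set (Config (State c) Cell)}
    (h₁ : Leads I L c web A B) (h₂ : Leads I L c web B C) : Leads I L c web A C := by
  intro κ hκ
  obtain ⟨κ', hκ', h⟩ := h₁ κ hκ
  obtain ⟨κ'', hκ'', h'⟩ := h₂ κ' hκ'
  exact ⟨κ'', hκ'', TransGen.trans h h'⟩

variable {web : SymTape} {m m' : Mode} {v v' : Option Bin} {l l' : List Bin} {w w' : List Sym}
  {pos pos' : ℕ} {out out' : List Sym}

/-- One step of the driver enters the routine at `lab`; the routine then runs in mode `m'` until it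
halts. Every push, pop and evaluation is an instance. -/
theorem leads_of_call {lab : Label} (hlab : lab ∈ labels c)
    (hd : ∀ a, dispatch (c := c) a (tapeOf (w.map Sum.inl) pos) v m =
      some (idleAction a (tapeOf (w.map Sum.inl) pos) (.run m' (call lab hlab))))
    (h : Reaches (TM2.step prog) ⟨some lab, none, K'.elim l [] [] []⟩
      ⟨none, v', K'.elim l' [] [] []⟩) :
    Leads I L c web (idle c m v l w pos out) (idle c m' v' l' w pos out) := by
  rintro _ ⟨T, hT, rfl⟩
  obtain ⟨T', hT', h'⟩ := reaches_prog₀ h hT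
  refine ⟨_, ⟨T', hT', rfl⟩, TransGen.head' (b := config m' (call lab hlab) T w pos out) ?_
    (reaches_config I L web m' w pos out h')⟩
  rw [next_config_halted, hd]
  refine congrArg some ?_
  simp [Config.apply, idleAction, config, movePos, moveTape, ← Tape.map_fst, Tape.write_self]

theorem leads_of_dispatch {q : Action (State c) Cell → Action (State c) Cell}
    (hd : ∀ a, dispatch (c := c) a (tapeOf (w.map Sum.inl) pos) v m =
      some (q (idleAction a (tapeOf (w.map Sum.inl) pos) (.run m' (halted v')))))
    (hq : ∀ T : Tape Cell, (config m (halted v) T w pos out).apply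
      (q (idleAction (toSym T.head) (tapeOf (w.map Sum.inl) pos) (.run m' (halted v')))) =
        config m' (halted v') T w' pos' out') :
    Leads I L c web (idle c m v l w pos out) (idle c m' v' l w' pos' out') := by
  rintro _ ⟨T, hT, rfl⟩
  refine ⟨_, ⟨T, hT, rfl⟩, TransGen.single ?_⟩
  rw [next_config_halted, hd]
  exact congrArg some (hq T)

theorem leads_init : Leads I L c web (idle c .init v l w pos out)
    (idle c .sep none (Γ'.cons :: l) w pos out) :=
  leads_of_call _ (fun _ => rfl) (reaches_push _ _ _)

/-- The two pushes put the number 1, the code of the empty word, in front of the memory as a new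
first argument. -/
theorem leads_sep : Leads I L c web (idle c .sep v l w pos out)
    (idle c .read none (Γ'.bit1 :: Γ'.cons :: l) w pos out) :=
  (leads_of_call (m' := .one) _ (fun _ => rfl) (reaches_push _ _ _)).trans
    (leads_of_call _ (fun _ => rfl) (reaches_push _ _ _))

theorem leads_pushing (k : ℕ) (hk : k < 32) :
    Leads I L c web (idle c (.pushing (Fin.ofNat 32 k)) v l w pos out)
      (idle c .read none (Γ'.bit1 :: (List.replicate k Γ'.bit0 ++ l)) w pos out) := by
  induction k generalizing v l with
  | zero => exact leads_of_call _ (fun _ => rfl) (reaches_push _ _ _)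
  | succ k ih =>
    -- Since `k + 1 < 32`, counting down in `Fin 32` does not wrap around.
    have hne : Fin.ofNat 32 (k + 1) ≠ 0 := by
      rw [Ne, Fin.ext_iff]
      simp only [Fin.val_ofNat, Fin.val_zero]
      omega
    have hsub : Fin.ofNat 32 (k + 1) - 1 = Fin.ofNat 32 k := by
      rw [Fin.ext_iff, Fin.sub_val_of_le]
      · simp only [Fin.val_ofNat, Fin.val_one]
        omega
      · rw [Fin.le_def]
        simp only [Fin.val_ofNat, Fin.val_one]
        omega
    have := ih (v := none) (l := Γ'.bit0 :: l) (by omega)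
    rw [List.append_cons, ← List.replicate_succ'] at this
    refine Leads.trans (leads_of_call (inr_mem_labels c _) (fun a => ?_) (reaches_push _ _ _)) this
    simp only [dispatch, if_neg hne, hsub]
    rfl

/-- Push the numbers of the symbols of a word in unary. -/
def pushWord (r : List Sym) (l : List Bin) : List Bin :=
  r.foldl (fun l s => Γ'.bit1 :: (List.replicate s.code Γ'.bit0 ++ l)) l

/-- The head consumes the unread symbols one at a time, pushing each in unary; the first blank marks
the end of the word and triggers the evaluation. -/
theorem leads_read {v l args res} (r : List Sym) (hl : pushWord r l = trList args)
    (hres : res ∈ c.eval args) :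
    Leads I L c web (idle c .read v l (w ++ r) w.length out)
      (idle c (.pop 0) none (trList res) (w ++ r) (w ++ r).length out) := by
  induction r generalizing v l w with
  | nil =>
    rw [List.append_nil]
    refine leads_of_call (trNormal_mem_labels c) (fun a => ?_) ?_
    · simp [dispatch, tapeOf, callCode]
    · have hl' : l = trList args := hl
      subst hl'
      exact reaches_eval hres
  | cons s r ih =>
    have hs : tapeOf ((w ++ s :: r).map (Sum.inl (β := Cell))) w.length = some (Sum.inl s) := by
      simp [tapeOf]
    refine Leads.trans (leads_of_dispatch (v' := none) (m' := .pushing (Fin.ofNat 32 s.code))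
      (w' := w ++ s :: r) (pos' := w.length + 1) (out' := out)
      (q := fun a => { a with linkMove := some Dir.right }) (fun a => ?_) (fun T => ?_)) ?_
    · simp only [dispatch, hs]
    · simp [Config.apply, idleAction, config, movePos, moveTape, ← Tape.map_fst, Tape.write_self]
    · refine (leads_pushing _ (s.code_lt.trans (by norm_num))).trans ?_
      simpa using ih (w := w ++ [s]) hl

/-- Counts the zeros on top of the stack in the finite control; the terminating `bit1` is popped as
well, leaving only the new memory. -/
theorem leads_popped (k j : ℕ) (hkj : k + j < 32) :
    Leads I L c web
      (idle c (.pop (Fin.ofNat 32 k)) v (List.replicate j Γ'.bit0 ++ Γ'.bit1 :: l) w pos out)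
      (idle c (.popped (Fin.ofNat 32 (k + j))) (some Γ'.bit1) l w pos out) := by
  induction j generalizing v k with
  | zero => exact leads_of_call _ (fun _ => rfl) (reaches_pop _ _)
  | succ j ih =>
    have h₁ : Leads I L c web (idle c (.pop (Fin.ofNat 32 k)) v
        (List.replicate (j + 1) Γ'.bit0 ++ Γ'.bit1 :: l) w pos out) _ :=
      leads_of_call (m' := .popped (Fin.ofNat 32 k)) _ (fun _ => rfl) (reaches_pop _ _)
    have hadd : Fin.ofNat 32 k + 1 = Fin.ofNat 32 (k + 1) := by
      rw [Fin.ext_iff, Fin.val_add]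
      simp only [Fin.val_ofNat, Fin.val_one]
      omega
    have h₂ := ih (v := none) (k + 1) (by omega)
    rw [show k + 1 + j = k + (j + 1) by omega] at h₂
    refine h₁.trans (Leads.trans (leads_of_dispatch (q := id) (fun a => ?_) (fun T => ?_)) h₂)
    · rw [← hadd]
      rfl
    · simp [Config.apply, idleAction, config, movePos, moveTape, ← Tape.map_fst, Tape.write_self]

variable {k : Fin 32}

theorem leads_emit {s : Sym} (hk : cmdOf k = .emit s) :
    Leads I L c web (idle c (.popped k) (some Γ'.bit1) l w pos out)
      (idle c .sep none l w pos (out ++ [s])) := by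
  refine leads_of_dispatch (q := fun a => { a with output := some s }) (fun a => ?_) (fun T => ?_)
  · simp [dispatch, hk, execute]
  · simp [Config.apply, idleAction, config, movePos, moveTape, ← Tape.map_fst, Tape.write_self]

theorem leads_write {s : Sym} (hk : cmdOf k = .write s) :
    Leads I L c web (idle c (.popped k) (some Γ'.bit1) l w w.length out)
      (idle c .sep none l (w ++ [s]) (w ++ [s]).length out) := by
  refine leads_of_dispatch
    (q := fun a => { a with linkWrite := some (Sum.inl s), linkMove := some Dir.right })
    (fun a => ?_) (fun T => ?_)
  · simp [dispatch, hk, execute]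
  · have := update_tapeOf (w.map (Sum.inl (β := Cell))) (Sum.inl s)
    rw [List.length_map] at this
    simp [Config.apply, idleAction, config, movePos, moveTape, ← Tape.map_fst, Tape.write_self,
      this]

/-- Two steps are made, one into the expand state and one out of it. The head stays put, so the
appended answer is left for the next round to read. -/
theorem leads_expand (hk : cmdOf k = .expand) :
    Leads I L c web (idle c (.popped k) (some Γ'.bit1) l w pos out)
      (idle c .sep none l (w ++ expandWord I L web (w.map fun s => some (Sum.inl (β := Cell) s)))
        pos out) := by
  rintro _ ⟨T, hT, rfl⟩
  refine ⟨_, ⟨T, hT, rfl⟩, TransGen.head (b :=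
    { config (.popped k) (halted (c := c) (some Γ'.bit1)) T w pos out with
    state := State.expand }) ?_ (TransGen.single ?_)⟩
  · rw [next_config_halted]
    have : dispatch (c := c) (toSym T.head) (tapeOf (w.map Sum.inl) pos) (some Γ'.bit1)
        (.popped k) = some (idleAction (toSym T.head) (tapeOf (w.map Sum.inl) pos) .expand) := by
      simp [dispatch, hk, execute]
    rw [this]
    refine congrArg some ?_
    simp [Config.apply, idleAction, config, movePos, moveTape, ← Tape.map_fst, Tape.write_self]
  · refine Option.mem_def.2 (((machine c).step_of_eq web [] rfl).trans ?_)
    refine congrArg some ?_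
    have h : appendWord (tapeOf (w.map (Sum.inl (β := Cell))))
        ((expandWord I L web (tapeWord (tapeOf (w.map (Sum.inl (β := Cell)))))).map Sum.inl) =
        tapeOf ((w ++ expandWord I L web (w.map fun s => some (Sum.inl (β := Cell) s))).map
          Sum.inl) := by
      rw [appendWord_tapeOf, tapeWord_tapeOf, List.map_append, List.map_map]
      rfl
    simp only [Config.expand, config, machine, Config.apply, idleAction, movePos, moveTape,
      Option.toList_none, List.append_nil, Function.update_eq_self]
    rw [← h]
    congr 1

theorem next_halt (hk : cmdOf k = .halt) {κ : Config (State c) Cell}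
    (hκ : κ ∈ idle c (.popped k) (some Γ'.bit1) l w pos out) :
    next I L c web κ = none ∧ κ.out = out := by
  obtain ⟨T, -, rfl⟩ := hκ
  rw [next_config_halted]
  simp [dispatch, hk, execute, config]

/-! ### Arithmetic of stack contents: the least significant digit is on top -/

theorem trNat_two_mul_add_one (n : ℕ) : trNat (2 * n + 1) = Γ'.bit1 :: trNat n := by
  have : ((2 * n + 1 : ℕ) : Num) = (n : Num).bit1 := by
    rw [← Num.bit1_of_bit1, two_mul]
    push_cast
    rfl
  rw [trNat, this]
  cases h : (n : Num) <;> simp [trNat, h, Num.bit1, trNum, trPosNum]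

/-- The case `n = 0` must be excluded because zero has no digits; the codes in use keep a digit 1
above the zeros for this reason. -/
theorem trNat_two_mul {n : ℕ} (hn : n ≠ 0) : trNat (2 * n) = Γ'.bit0 :: trNat n := by
  have : ((2 * n : ℕ) : Num) = (n : Num).bit0 := by
    rw [← Num.bit0_of_bit0, two_mul]
    push_cast
    rfl
  rw [trNat, this]
  cases h : (n : Num) with
  | zero =>
    have h0 : (n : Num) = ((0 : ℕ) : Num) := by rw [h]; rfl
    exact absurd (by exact_mod_cast h0) hn
  | pos p => simp [trNat, h, Num.bit0, trNum, trPosNum]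

theorem trNat_two_pow_mul (k : ℕ) {n : ℕ} (hn : n ≠ 0) :
    trNat (2 ^ k * n) = List.replicate k Γ'.bit0 ++ trNat n := by
  induction k with
  | zero => simp
  | succ k ih =>
    rw [pow_succ', mul_assoc, trNat_two_mul (by positivity), ih]
    rfl

/-- Append the number `k` in unary to the binary digits of `n`. -/
def snocUnary (n k : ℕ) : ℕ := 2 * (2 ^ k * n) + 1

/-- The number whose binary digits are the unary numbers of the symbols of a word. -/
def wordNum (r : List Sym) : ℕ := r.foldl (fun n s => snocUnary n s.code) 1

theorem pushWord_trNat (r : List Sym) {n : ℕ} (hn : n ≠ 0) (l : List Bin) :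
    pushWord r (trNat n ++ l) = trNat (r.foldl (fun n s => snocUnary n s.code) n) ++ l := by
  induction r generalizing n with
  | nil => rfl
  | cons s r ih =>
    have := ih (n := snocUnary n s.code) (by simp [snocUnary])
    rw [snocUnary, trNat_two_mul_add_one, trNat_two_pow_mul _ hn] at this
    simpa [pushWord, snocUnary] using this

theorem pushWord_trList (r : List Sym) (m : ℕ) :
    pushWord r (Γ'.bit1 :: Γ'.cons :: trList [m]) = trList [wordNum r, m] := by
  have h1 : trNat 1 = [Γ'.bit1] := by simpa using trNat_two_mul_add_one 0
  simpa [h1, wordNum] using pushWord_trNat r one_ne_zero (Γ'.cons :: trList [m])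

/-- The number that makes the driver machine perform a command and remember `n`. -/
def _root_.LinkedData.Cmd.num (a : Cmd) (n : ℕ) : ℕ := 2 ^ a.code * (2 * n + 1)

/-- The number `a.num n` has `a.code` zeros, then a 1, then the digits of `n`. Counting zeros
therefore identifies the command and uncovers `n` as the only entry of the stack. -/
theorem leads_round (a : Cmd) {m n : ℕ} {r : List Sym}
    (h : [a.num n] ∈ c.eval [wordNum r, m]) :
    Leads I L c web (idle c .sep v (trList [m]) (w ++ r) w.length out)
      (idle c (.popped (Fin.ofNat 32 a.code)) (some Γ'.bit1) (trList [n]) (w ++ r)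
        (w ++ r).length out) := by
  refine leads_sep.trans ((leads_read r (pushWord_trList r m) h).trans ?_)
  have := leads_popped (I := I) (L := L) (c := c) (web := web) (v := none) (l := trList [n])
    (w := w ++ r) (pos := (w ++ r).length) (out := out) 0 a.code (by simpa using a.code_lt)
  rw [zero_add] at this
  have h' : trList [a.num n] =
      List.replicate a.code Γ'.bit0 ++ Γ'.bit1 :: trList [n] := by
    simp [Cmd.num, trNat_two_pow_mul, trNat_two_mul_add_one]
  rw [h']
  exact this

theorem cmdOf_ofNat (a : Cmd) : cmdOf (Fin.ofNat 32 a.code) = a := by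
  rw [Fin.val_ofNat, Nat.mod_eq_of_lt a.code_lt, cmdOf_code]

variable (c) in
/-- The configurations between two rounds: the program remembers `m`, the word on the link traversal
tape is `w ++ r`, and `r` has not been read. -/
def ready (m : ℕ) (w r out : List Sym) : Set (Config (State c) Cell) :=
  {κ | ∃ v, κ ∈ idle c .sep v (trList [m]) (w ++ r) w.length out}

variable {n k : ℕ} {r : List Sym}

theorem leads_ready_emit {s : Sym} (h : [(Cmd.emit s).num n] ∈ c.eval [wordNum r, k]) :
    Leads I L c web (ready c k w r out) (ready c n (w ++ r) [] (out ++ [s])) := by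
  rintro κ ⟨v, hκ⟩
  obtain ⟨κ', h₁, h₂⟩ := (leads_round (I := I) (L := L) (.emit s) h).trans
    (leads_emit (cmdOf_ofNat _)) κ hκ
  exact ⟨κ', ⟨none, by simpa using h₁⟩, h₂⟩

theorem leads_ready_write {s : Sym} (h : [(Cmd.write s).num n] ∈ c.eval [wordNum r, k]) :
    Leads I L c web (ready c k w r out) (ready c n (w ++ r ++ [s]) [] out) := by
  rintro κ ⟨v, hκ⟩
  obtain ⟨κ', h₁, h₂⟩ := (leads_round (I := I) (L := L) (.write s) h).trans
    (leads_write (cmdOf_ofNat _)) κ hκ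
  exact ⟨κ', ⟨none, by simpa using h₁⟩, h₂⟩

theorem leads_ready_expand (h : [Cmd.expand.num n] ∈ c.eval [wordNum r, k]) :
    Leads I L c web (ready c k w r out) (ready c n (w ++ r)
      (expandWord I L web ((w ++ r).map fun s => some (Sum.inl (β := Cell) s))) out) := by
  rintro κ ⟨v, hκ⟩
  obtain ⟨κ', h₁, h₂⟩ := (leads_round (I := I) (L := L) .expand h).trans
    (leads_expand (cmdOf_ofNat _)) κ hκ
  exact ⟨κ', ⟨none, h₁⟩, h₂⟩

theorem reaches_ready_halt (h : [Cmd.halt.num n] ∈ c.eval [wordNum r, k])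
    {κ : Config (State c) Cell} (hκ : κ ∈ ready c k w r out) :
    ∃ κ', Reaches (next I L c web) κ κ' ∧ next I L c web κ' = none ∧ κ'.out = out := by
  obtain ⟨v, hκ⟩ := hκ
  obtain ⟨κ', h₁, h₂⟩ := leads_round (I := I) (L := L) (web := web) .halt h κ hκ
  exact ⟨κ', h₂.to_reflTransGen, next_halt (cmdOf_ofNat _) h₁⟩

/-- The boot step turns the blank work tape into the representation of empty stacks. Zero has no
digits, so pushing a single separator then gives `trList [0]`. -/
theorem reaches_ready_init (web : SymTape) :
    ∃ κ ∈ ready c 0 [] [] [], Reaches (next I L c web) (machine c).init κ := by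
  have h₀ : Holds (Tape.mk' ∅ (TM2to1.addBottom ∅)) [] := by
    refine ⟨∅, fun k => ?_, rfl⟩
    cases k <;> rfl
  have h : config (c := c) .init (halted none) (Tape.mk' ∅ (TM2to1.addBottom ∅)) [] 0 [] ∈
      next I L c web (machine c).init := by
    refine Option.mem_def.2 (((machine c).step_of_ne web []
      (by intro h; cases h)).trans ?_)
    refine congrArg some ?_
    simp only [Config.apply, idleAction, LDMachine.init, config, movePos, moveTape,
      Option.toList_none, List.append_nil, Function.update_eq_self, List.map_nil]
    rw [Tape.map_mk']
    congr 1
  obtain ⟨κ, hκ, h'⟩ := leads_init (I := I) (L := L) (c := c) (web := web) (v := none) (l := [])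
    (w := []) (pos := 0) (out := []) _ ⟨_, h₀, rfl⟩
  exact ⟨κ, ⟨none, by simpa using hκ⟩, ReflTransGen.head h h'.to_reflTransGen⟩

end Run

end Driver

end LinkedData


namespace LinkedData

/-! ## Unique readability of the encodings -/

/-- The longest initial segment satisfying `p` is unique. This is the source of all unique
readability below. -/
theorem List.eq_of_append_eq_append {α : Type*} {p : α → Prop} {a a' r r' : List α}
    (ha : ∀ s ∈ a, p s) (ha' : ∀ s ∈ a', p s) (hr : ∀ s ∈ r.head?, ¬ p s)
    (hr' : ∀ s ∈ r'.head?, ¬ p s) (h : a ++ r = a' ++ r') : a = a' ∧ r = r' := by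
  induction a generalizing a' with
  | nil =>
    cases a' with
    | nil => exact ⟨rfl, h⟩
    | cons x a' =>
      simp only [List.nil_append, List.cons_append] at h
      subst h
      exact absurd (ha' x (by simp)) (hr x (by simp))
  | cons x a ih =>
    cases a' with
    | nil =>
      simp only [List.nil_append, List.cons_append] at h
      subst h
      exact absurd (ha x (by simp)) (hr' x (by simp))
    | cons x' a' =>
      simp only [List.cons_append, List.cons.injEq] at h
      obtain ⟨rfl, h⟩ := h
      obtain ⟨rfl, rfl⟩ := ih (fun s hs => ha s (by simp [hs])) (fun s hs => ha' s (by simp [hs])) h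
      exact ⟨rfl, rfl⟩

/-- The symbol is a binary digit. -/
def Sym.IsBit (s : Sym) : Prop := ∃ b, s = Sym.bit b

theorem isBit_of_mem_encBin {α : Type} [Denumerable α] {a : α} {s : Sym} (h : s ∈ encBin a) :
    s.IsBit := by
  simp only [encBin, List.mem_map] at h
  obtain ⟨b, -, rfl⟩ := h
  exact ⟨b, rfl⟩

theorem ofBits_bits (n : ℕ) : n.bits.foldr (fun b n => Nat.bit b n) 0 = n := by
  induction n using Nat.binaryRec' with
  | zero => simp
  | bit b n h ih => rw [Nat.bits_append_bit _ _ h, List.foldr_cons, ih]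

theorem encBin_injective {α : Type} [Denumerable α] :
    Function.Injective (encBin : α → List Sym) := by
  intro a b h
  have h' : Nat.bits (Encodable.encode a + 1) = Nat.bits (Encodable.encode b + 1) :=
    List.map_injective_iff.2 (fun x y h => by cases h; rfl) h
  have := congrArg (fun l : List Bool => l.foldr (fun b n => Nat.bit b n) 0) h'
  simp only [ofBits_bits, Nat.add_right_cancel_iff] at this
  exact Encodable.encode_injective this

theorem encBin_append_inj {α : Type} [Denumerable α] {a a' : α} {s s' : Sym} {r r' : List Sym}
    (hs : ¬ s.IsBit) (hs' : ¬ s'.IsBit) (h : encBin a ++ s :: r = encBin a' ++ s' :: r') :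
    a = a' ∧ s = s' ∧ r = r' := by
  obtain ⟨h₁, h₂⟩ := List.eq_of_append_eq_append (p := Sym.IsBit)
    (fun _ => isBit_of_mem_encBin) (fun _ => isBit_of_mem_encBin) (by simpa using hs)
    (by simpa using hs') h
  exact ⟨encBin_injective h₁, List.cons.inj h₂⟩

theorem not_isBit_comma : ¬ Sym.comma.IsBit := by rintro ⟨_, h⟩; cases h
theorem not_isBit_tripleR : ¬ Sym.tripleR.IsBit := by rintro ⟨_, h⟩; cases h
theorem not_isBit_setL : ¬ Sym.setL.IsBit := by rintro ⟨_, h⟩; cases h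
theorem not_isBit_sharp : ¬ Sym.sharp.IsBit := by rintro ⟨_, h⟩; cases h

theorem intercalate_singleton_cons {α : Type*} (s a : List α) (l : List (List α)) :
    s.intercalate (a :: l) = a ++ l.flatMap fun x => s ++ x := by
  induction l generalizing a with
  | nil => simp [List.intercalate]
  | cons b l ih =>
    rw [List.flatMap_cons, List.append_assoc, ← ih b]
    simp [List.intercalate]

section Encoding

variable {I L : Type} [Denumerable I] [Denumerable L]

/-- Each component is a binary word followed by a non-digit, so the components can be peeled off
from the left whatever follows. -/
theorem encTriple_append_inj {t t' : DataTriple I L} {r r' : List Sym}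
    (h : encTriple t ++ r = encTriple t' ++ r') : t = t' ∧ r = r' := by
  obtain ⟨s, p, o⟩ := t
  obtain ⟨s', p', o'⟩ := t'
  simp only [encTriple, encId, encTerm, List.append_assoc, List.cons_append, List.nil_append,
    List.cons.injEq, true_and] at h
  obtain ⟨h₁, -, h⟩ := encBin_append_inj not_isBit_comma not_isBit_comma h
  obtain ⟨h₂, -, h⟩ := encBin_append_inj not_isBit_comma not_isBit_comma h
  obtain ⟨h₃, -, h₄⟩ := encBin_append_inj not_isBit_tripleR not_isBit_tripleR h
  cases h₁
  cases h₂
  cases h₃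
  exact ⟨rfl, h₄⟩

/-- Encoding of a list of data triples. -/
def encTripleList (l : List (DataTriple I L)) : List Sym :=
  [Sym.setL] ++ [Sym.comma].intercalate (l.map encTriple) ++ [Sym.setR]

theorem encTripleList_sorted (T : Finset (DataTriple I L)) :
    encTripleList (sorted T) = encTriples T := rfl

theorem flatMap_encTriple_inj {l l' : List (DataTriple I L)} {r r' : List Sym}
    (h : (l.map encTriple).flatMap (fun x => [Sym.comma] ++ x) ++ Sym.setR :: r =
      (l'.map encTriple).flatMap (fun x => [Sym.comma] ++ x) ++ Sym.setR :: r') :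
    l = l' ∧ r = r' := by
  induction l generalizing l' with
  | nil =>
    cases l' with
    | nil => simpa using h
    | cons t l' => simp at h
  | cons t l ih =>
    cases l' with
    | nil => simp at h
    | cons t' l' =>
      simp only [List.map_cons, List.flatMap_cons, List.append_assoc, List.cons_append,
        List.nil_append, List.cons.injEq, true_and] at h
      obtain ⟨rfl, h'⟩ := encTriple_append_inj h
      obtain ⟨rfl, rfl⟩ := ih h'
      exact ⟨rfl, rfl⟩

theorem encTripleList_append_inj {l l' : List (DataTriple I L)} {r r' : List Sym}
    (h : encTripleList l ++ r = encTripleList l' ++ r') : l = l' ∧ r = r' := by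
  cases l with
  | nil =>
    cases l' with
    | nil => simpa [encTripleList] using h
    | cons t l' =>
      rw [encTripleList, encTripleList, List.map_cons, intercalate_singleton_cons] at h
      simp [List.intercalate, encTriple] at h
  | cons t l =>
    cases l' with
    | nil =>
      rw [encTripleList, encTripleList, List.map_cons, intercalate_singleton_cons] at h
      simp [List.intercalate, encTriple] at h
    | cons t' l' =>
      simp only [encTripleList, List.map_cons, intercalate_singleton_cons, List.append_assoc,
        List.cons_append, List.nil_append, List.cons.injEq, true_and] at h
      obtain ⟨rfl, h'⟩ := encTriple_append_inj h
      obtain ⟨rfl, rfl⟩ := flatMap_encTriple_inj h'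
      exact ⟨rfl, rfl⟩

theorem encTripleList_injective : Function.Injective (encTripleList (I := I) (L := L)) :=
  fun l l' h => (encTripleList_append_inj (r := []) (r' := []) (by rw [h])).1

theorem sharp_notMem_encBin {α : Type} [Denumerable α] (a : α) : Sym.sharp ∉ encBin a :=
  fun h => not_isBit_sharp (isBit_of_mem_encBin h)

theorem sharp_notMem_encTriple (t : DataTriple I L) : Sym.sharp ∉ encTriple t := by
  simp [encTriple, encId, encTerm, sharp_notMem_encBin]

theorem sharp_notMem_encTripleList (l : List (DataTriple I L)) : Sym.sharp ∉ encTripleList l := by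
  cases l with
  | nil => simp [encTripleList, List.intercalate]
  | cons t l =>
    simp only [encTripleList, List.map_cons, intercalate_singleton_cons, List.mem_append,
      List.mem_flatMap, List.mem_map, List.mem_singleton, reduceCtorEq, false_or, or_false, not_or]
    refine ⟨sharp_notMem_encTriple t, ?_⟩
    rintro ⟨_, ⟨t', -, rfl⟩, h⟩
    exact sharp_notMem_encTriple t' h

theorem encId_append_encTripleList_inj {u u' : I} {l l' : List (DataTriple I L)}
    (h : encId L u ++ encTripleList l = encId L u' ++ encTripleList l') : u = u' ∧ l = l' := by
  have h' := h
  simp only [encTripleList, encId, encTerm, List.cons_append, List.nil_append] at h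
  obtain ⟨h₁, -, -⟩ := encBin_append_inj not_isBit_setL not_isBit_setL h
  cases h₁
  exact ⟨rfl, encTripleList_injective (List.append_cancel_left h')⟩

theorem HasBinarySuffix.unique {A : Type} {w : List (TapeSym A)} {u u' : I}
    (h : HasBinarySuffix w (encId L u)) (h' : HasBinarySuffix w (encId L u')) : u = u' := by
  obtain ⟨pre, hw, hpre⟩ := h
  obtain ⟨pre', hw', hpre'⟩ := h'
  let p : TapeSym A → Prop := fun s => ∃ b, s = some (Sum.inl (Sym.bit b))
  have hp : ∀ u : I, ∀ s ∈ ((encId L u).map (fun s => (some (Sum.inl s) : TapeSym A))).reverse,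
      p s := by
    intro u s hs
    simp only [List.mem_reverse, List.mem_map] at hs
    obtain ⟨s, hs, rfl⟩ := hs
    obtain ⟨b, rfl⟩ := isBit_of_mem_encBin hs
    exact ⟨b, rfl⟩
  have hq : ∀ pre : List (TapeSym A), (∀ b, pre.getLast? ≠ some (some (Sum.inl (Sym.bit b)))) →
      ∀ s ∈ pre.reverse.head?, ¬ p s := by
    rintro pre hpre s hs ⟨b, rfl⟩
    rw [List.head?_reverse] at hs
    exact hpre b hs
  -- After reversal a maximal binary suffix is a maximal binary prefix.
  have h := congrArg List.reverse (hw.symm.trans hw')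
  rw [List.reverse_append, List.reverse_append] at h
  have := (List.eq_of_append_eq_append (hp u) (hp u') (hq _ hpre) (hq _ hpre') h).1
  have := List.map_injective_iff.2
    (fun x y h => by simpa using h) (List.reverse_injective this)
  exact Sum.inl_injective (encBin_injective this)

/-! ## The content of the Web tape -/

variable (W : Web I L)

/-- The part of the encoding of a Web for an identifier. -/
def Web.encEntry (u : I) : List Sym :=
  match W.adoc u with
  | none => []
  | some d => encId L u ++ W.encDoc d ++ [Sym.sharp]

theorem Web.encPrefix_eq (n : ℕ) : W.encPrefix n =
    [Sym.sharp] ++ (List.range n).flatMap fun k => W.encEntry (Denumerable.ofNat I k) := rfl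

theorem Web.encPrefix_succ (n : ℕ) :
    W.encPrefix (n + 1) = W.encPrefix n ++ W.encEntry (Denumerable.ofNat I n) := by
  simp [Web.encPrefix_eq, List.range_succ]

theorem Web.encPrefix_prefix {m n : ℕ} (h : m ≤ n) : W.encPrefix m <+: W.encPrefix n := by
  induction n, h using Nat.le_induction with
  | base => exact List.prefix_rfl
  | succ n _ ih => exact ih.trans ⟨_, (W.encPrefix_succ n).symm⟩

theorem Web.exists_encPrefix_eq (n : ℕ) : ∃ p, W.encPrefix n = p ++ [Sym.sharp] := by
  induction n with
  | zero => exact ⟨[], rfl⟩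
  | succ n ih =>
    obtain ⟨p, hp⟩ := ih
    rw [W.encPrefix_succ, hp, Web.encEntry]
    cases W.adoc (Denumerable.ofNat I n) with
    | none => exact ⟨p, by simp⟩
    | some d => exact ⟨p ++ [Sym.sharp] ++ (encId L (Denumerable.ofNat I n) ++ W.encDoc d), by simp⟩

theorem Web.getElem?_encPrefix {m n i : ℕ} {s s' : Sym} (h : (W.encPrefix m)[i]? = some s)
    (h' : (W.encPrefix n)[i]? = some s') : s = s' := by
  have key : ∀ {m n : ℕ}, m ≤ n → ∀ {s : Sym}, (W.encPrefix m)[i]? = some s →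
      (W.encPrefix n)[i]? = some s := by
    intro m n hmn s hs
    obtain ⟨r, hr⟩ := W.encPrefix_prefix hmn
    rw [← hr, List.getElem?_append_left (List.getElem?_eq_some_iff.1 hs).1, hs]
  have h₁ := key (le_max_left m n) h
  rw [key (le_max_right m n) h'] at h₁
  exact (Option.some.inj h₁).symm

theorem Web.enc_eq_some_iff {i : ℕ} {s : Sym} :
    W.enc i = some s ↔ ∃ n, (W.encPrefix n)[i]? = some s := by
  rw [Web.enc]
  split_ifs with h
  · obtain ⟨n, hn⟩ := h.choose_spec
    refine ⟨fun hs => ⟨n, hn.trans hs⟩, fun ⟨m, hm⟩ => congrArg some ?_⟩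
    exact W.getElem?_encPrefix hn hm
  · refine ⟨fun h' => (nomatch h'), fun h' => absurd ⟨s, h'⟩ h⟩

/-- A finite word meets finitely many cells of the tape, and all of them are already filled in one
sufficiently long finite prefix. -/
theorem Web.contains_enc_iff {x : List Sym} : SymTape.Contains W.enc x ↔
    ∃ n, x <:+: W.encPrefix n := by
  constructor
  · rintro ⟨i, hi⟩
    have hi' : ∀ j < x.length, ∃ n, ∀ m, n ≤ m → (W.encPrefix m)[i + j]? = x[j]? := by
      intro j hj
      obtain ⟨n, hn⟩ := W.enc_eq_some_iff.1 (hi j hj)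
      refine ⟨n, fun m hm => ?_⟩
      obtain ⟨r, hr⟩ := W.encPrefix_prefix hm
      rw [← hr, List.getElem?_append_left (List.getElem?_eq_some_iff.1 hn).1, hn,
        List.getElem?_eq_getElem hj]
    choose! N hN using hi'
    refine ⟨(Finset.range x.length).sup N, ?_⟩
    rw [List.infix_iff_prefix_suffix]
    refine ⟨(W.encPrefix ((Finset.range x.length).sup N)).drop i, ?_, List.drop_suffix _ _⟩
    rw [List.prefix_iff_getElem?]
    intro j hj
    rw [List.getElem?_drop, hN j hj _ (Finset.le_sup (f := N) (Finset.mem_range.2 hj)),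
      List.getElem?_eq_getElem hj]
  · rintro ⟨n, p, r, h⟩
    refine ⟨p.length, fun j hj => W.enc_eq_some_iff.2 ⟨n, ?_⟩⟩
    rw [← h, List.append_assoc, List.getElem?_append_right (by omega), Nat.add_sub_cancel_left,
      List.getElem?_append_left hj, List.getElem?_eq_getElem hj]

/-- A separator-free word between two separators cannot straddle blocks, so it is a whole block. -/
theorem exists_mem_of_append_sep {α : Type*} {a : α} {bs : List (List α)}
    (hbs : ∀ b ∈ bs, a ∉ b) {pre y suf : List α} (hy : a ∉ y)
    (h : a :: bs.flatMap (fun b => b ++ [a]) = pre ++ a :: (y ++ a :: suf)) : y ∈ bs := by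
  induction bs generalizing pre with
  | nil =>
    have := congrArg List.length h
    simp at this
    omega
  | cons b bs ih =>
    have hb := hbs b (by simp)
    cases pre with
    | nil =>
      simp only [List.flatMap_cons, List.nil_append, List.cons.injEq, true_and, List.append_assoc,
        List.cons_append] at h
      obtain ⟨rfl, -⟩ := List.eq_of_append_eq_append (p := fun s => s ≠ a)
        (fun s hs e => hb (e ▸ hs)) (fun s hs e => hy (e ▸ hs)) (by simp) (by simp) h
      simp
    | cons x pre =>
      simp only [List.flatMap_cons, List.cons_append, List.cons.injEq, List.append_assoc,
        List.nil_append] at h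
      obtain ⟨rfl, h⟩ := h
      refine List.mem_cons_of_mem _ ?_
      rcases List.append_eq_append_iff.1 h with ⟨q, rfl, h'⟩ | ⟨q, rfl, h'⟩
      · exact ih (fun b hb => hbs b (by simp [hb])) (pre := q) h'
      · cases q with
        | nil => exact ih (fun b hb => hbs b (by simp [hb])) (pre := []) (by simpa using h'.symm)
        | cons z q =>
          simp only [List.cons_append, List.cons.injEq] at h'
          exact absurd (by simp [h'.1]) hb

theorem Web.encPrefix_eq_flatMap (n : ℕ) : ∃ bs : List (List Sym),
    W.encPrefix n = Sym.sharp :: bs.flatMap (fun b => b ++ [Sym.sharp]) ∧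
      ∀ b ∈ bs, ∃ u d, W.adoc u = some d ∧ b = encId L u ++ W.encDoc d := by
  induction n with
  | zero => exact ⟨[], rfl, by simp⟩
  | succ n ih =>
    obtain ⟨bs, h, hbs⟩ := ih
    rw [W.encPrefix_succ, h, Web.encEntry]
    cases hd : W.adoc (Denumerable.ofNat I n) with
    | none => exact ⟨bs, by simp, hbs⟩
    | some d =>
      refine ⟨bs ++ [encId L (Denumerable.ofNat I n) ++ W.encDoc d], by simp, fun b hb => ?_⟩
      rcases List.mem_append.1 hb with hb | hb
      · exact hbs b hb
      · exact ⟨_, d, hd, by simpa using hb⟩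

/-- Entries contain no sharp, so an occurrence between two sharps is a genuine entry, and unique
readability recovers its identifier and its data. From here on the Web tape can be replaced by
`adoc` and `data`. -/
theorem isLookup_enc_iff {A : Type} {w : List (TapeSym A)} {x : List Sym} :
    IsLookup I L W.enc w x ↔
      ∃ u d, HasBinarySuffix w (encId L u) ∧ W.adoc u = some d ∧ x = W.encDoc d := by
  constructor
  · rintro ⟨u, T, hw, rfl, hc⟩
    obtain ⟨n, pre, suf, hn⟩ := W.contains_enc_iff.1 hc
    obtain ⟨bs, hbs, hb⟩ := W.encPrefix_eq_flatMap n
    rw [hbs] at hn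
    have hmem : encId L u ++ encTriples T ∈ bs := by
      refine exists_mem_of_append_sep (a := Sym.sharp) (pre := pre) (suf := suf) ?_ ?_
        (hn.symm.trans (by simp))
      · intro b hb'
        obtain ⟨u, d, -, rfl⟩ := hb b hb'
        rw [List.mem_append, not_or]
        exact ⟨sharp_notMem_encBin _, sharp_notMem_encTripleList _⟩
      · rw [List.mem_append, not_or]
        exact ⟨sharp_notMem_encBin _, sharp_notMem_encTripleList _⟩
    obtain ⟨u', d, hd, h⟩ := hb _ hmem
    obtain ⟨rfl, h'⟩ := encId_append_encTripleList_inj h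
    refine ⟨u, d, hw, hd, ?_⟩
    rw [← encTripleList_sorted, h']
    rfl
  · rintro ⟨u, d, hw, hd, rfl⟩
    refine ⟨u, W.data d, hw, rfl, W.contains_enc_iff.2 ⟨Encodable.encode u + 1, ?_⟩⟩
    obtain ⟨p, hp⟩ := W.exists_encPrefix_eq (Encodable.encode u)
    refine ⟨p, [], ?_⟩
    rw [W.encPrefix_succ, hp, Denumerable.ofNat_encode, Web.encEntry, hd]
    simp [Web.encDoc]

end Encoding

end LinkedData


namespace LinkedData

open StateTransition Relation

/-! ### Counting the valuations encoded by a word -/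

section Encoding

variable {I L V : Type} [Denumerable I] [Denumerable L] [Denumerable V]

theorem mem_intercalate_singleton {α : Type*} {a s : α} {l : List (List α)}
    (h : a ∈ [s].intercalate l) : a = s ∨ ∃ x ∈ l, a ∈ x := by
  cases l with
  | nil => simp [List.intercalate] at h
  | cons x l =>
    rw [intercalate_singleton_cons] at h
    simp only [List.mem_append, List.mem_flatMap, List.mem_singleton] at h
    obtain h | ⟨y, hy, h | h⟩ := h
    · exact Or.inr ⟨x, by simp, h⟩
    · exact Or.inl h
    · exact Or.inr ⟨y, by simp [hy], h⟩

/-- Only the opening bracket contributes, so brackets count valuations and no parsing of the output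
is needed. -/
theorem count_setL_encValuation (X : Finset V) (μ : Valuation I L V) :
    (encValuation X μ).count Sym.setL = 1 := by
  have hnot : ∀ {α : Type} [Denumerable α] (a : α), Sym.setL ∉ encBin a :=
    fun a h => not_isBit_setL (isBit_of_mem_encBin h)
  rw [encValuation, List.count_append, List.count_append, List.count_singleton_self,
    List.count_eq_zero_of_not_mem, List.count_eq_zero_of_not_mem]
  · simp
  · intro h
    rcases mem_intercalate_singleton h with h | ⟨x, hx, h⟩
    · cases h
    · obtain ⟨v, -, rfl⟩ := List.mem_map.1 hx
      simp only [List.mem_append, hnot, List.mem_singleton, reduceCtorEq, false_or] at h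
      cases hv : μ v with
      | none => simp [hv] at h
      | some x =>
        rw [hv] at h
        exact hnot x h

theorem count_setL_flatMap (X : Finset V) (l : List (Valuation I L V)) :
    (l.flatMap (encValuation X)).count Sym.setL = l.length := by
  induction l with
  | nil => rfl
  | cons μ l ih => simp [count_setL_encValuation, ih, add_comm]

/-- A common word forces equal finite cardinalities, and an inclusion between finite sets of equal
size is an equality. -/
theorem IsEncoding.eq_of_subset {X : Finset V} {Ω Ω' : Set (Valuation I L V)} {w : List Sym}
    (h : IsEncoding X Ω w) (h' : IsEncoding X Ω' w) (hsub : Ω ⊆ Ω') : Ω' ⊆ Ω := by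
  obtain ⟨l, hl, hΩ, hw⟩ := h
  obtain ⟨l', hl', hΩ', hw'⟩ := h'
  have hlen : l.length = l'.length := by
    rw [← count_setL_flatMap X l, ← count_setL_flatMap X l', ← hw, ← hw']
  have hsp : l.Subperm l' :=
    List.subperm_of_subset hl fun μ hμ => (hΩ' μ).2 (hsub ((hΩ μ).1 hμ))
  have hp : l.Perm l' := hsp.perm_of_length_le hlen.ge
  exact fun μ hμ => (hΩ μ).1 (hp.mem_iff.2 ((hΩ' μ).2 hμ))

theorem IsEncoding.finite {X : Finset V} {Ω : Set (Valuation I L V)} {w : List Sym}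
    (h : IsEncoding X Ω w) : Ω.Finite := by
  obtain ⟨l, -, hΩ, -⟩ := h
  refine (List.finite_toSet l).subset fun μ hμ => (hΩ μ).2 hμ

end Encoding

/-! ### The adversary: adding data to a document that the run never inspects -/

section AddData

variable {I L V : Type}

open Classical in
/-- The valuation that maps each element of `X` to the identifier `a`. -/
noncomputable def constValuation (L : Type) (X : Finset V) (a : I) : Valuation I L V :=
  fun v => if v ∈ X then some (Sum.inl a) else none

/-- The data triple that results from a triple pattern by replacing each variable by `a`. -/
def TriplePattern.constTriple (a : I) (tp : TriplePattern I L V) : DataTriple I L :=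
  (tp.1.elim (fun _ => a) id, tp.2.1.elim (fun _ => a) id, tp.2.2.elim (fun _ => Sum.inl a) id)

theorem constValuation_injective {X : Finset V} (hX : X.Nonempty) :
    Function.Injective (constValuation (I := I) L X) := by
  intro a b h
  obtain ⟨v, hv⟩ := hX
  simpa [constValuation, hv] using congrFun h v

theorem constValuation_subst {P : BQP I L V} {tp : TriplePattern I L V} (htp : tp ∈ P) (a : I) :
    (constValuation L (BQP.vars P) a).subst tp =
      some (Sum.inl (tp.constTriple a).1, Sum.inl (tp.constTriple a).2.1,
        (tp.constTriple a).2.2) := by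
  have h : ∀ v, tp.HasVar v → constValuation L (BQP.vars P) a v = some (Sum.inl a) :=
    fun v hv => if_pos ((BQP.mem_vars P v).2 ⟨tp, htp, hv⟩)
  obtain ⟨x, y, z⟩ := tp
  have hx : x.elim (constValuation L (BQP.vars P) a) (fun u => some (Sum.inl u)) =
      some (Sum.inl (x.elim (fun _ => a) id)) := by
    cases x with
    | inl v => exact h v (Or.inl rfl)
    | inr u => rfl
  have hy : y.elim (constValuation L (BQP.vars P) a) (fun u => some (Sum.inl u)) =
      some (Sum.inl (y.elim (fun _ => a) id)) := by
    cases y with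
    | inl v => exact h v (Or.inr (Or.inl rfl))
    | inr u => rfl
  have hz : z.elim (constValuation L (BQP.vars P) a) some =
      some (z.elim (fun _ => Sum.inl a) id) := by
    cases z with
    | inl v => exact h v (Or.inr (Or.inr rfl))
    | inr u => rfl
  simp [Valuation.subst, hx, hy, hz, TriplePattern.constTriple]

open Classical in
/-- Add data triples to a document. -/
noncomputable def Web.addData (W : Web I L) (d : W.D) (T : Finset (DataTriple I L)) : Web I L where
  D := W.D
  data e := if e = d then W.data e ∪ T else W.data e
  adoc := W.adoc
  adoc_surj := W.adoc_surj

variable (W : Web I L) (d : W.D) (T : Finset (DataTriple I L))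

theorem Web.data_subset_addData (e : W.D) : W.data e ⊆ (W.addData d T).data e := by
  classical
  simp only [Web.addData]
  split_ifs
  · exact Finset.subset_union_left
  · exact subset_rfl

theorem Web.subset_addData : T ⊆ (W.addData d T).data d := by
  classical
  simp only [Web.addData, if_pos]
  exact Finset.subset_union_right

theorem Web.addData_data_of_ne {e : W.D} (h : e ≠ d) : (W.addData d T).data e = W.data e := by
  simp only [Web.addData, if_neg h]

variable [Denumerable I] [Denumerable L] [Denumerable V]

theorem CLDQuery.Reachable.addData {q : CLDQuery I L V} {e : W.D} (h : q.Reachable W e) :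
    q.Reachable (W.addData d T) e := by
  induction h with
  | seed u e hu he => exact .seed (W := W.addData d T) u e hu he
  | link e e' t u _ ht hu hc he' ih =>
    exact .link (W := W.addData d T) e e' t u ih (W.data_subset_addData d T e ht) hu hc he'

theorem CLDQuery.mem_allData_reachablePart {q : CLDQuery I L V} {t : DataTriple I L} :
    t ∈ (q.reachablePart W).allData ↔ ∃ e, q.Reachable W e ∧ t ∈ W.data e := by
  constructor
  · rintro ⟨⟨e, he⟩, ht⟩
    exact ⟨e, he, ht⟩
  · rintro ⟨e, he, ht⟩
    exact ⟨⟨e, he⟩, ht⟩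

/-- Reachability and the available data are monotone in the data, since the criterion looks at one
triple at a time and the query has no negation. -/
theorem CLDQuery.result_subset_addData (q : CLDQuery I L V) :
    q.result W ⊆ q.result (W.addData d T) := by
  rintro μ ⟨h₁, h₂⟩
  refine ⟨h₁, fun tp htp => ?_⟩
  obtain ⟨t, ht, hμ⟩ := h₂ tp htp
  obtain ⟨e, he, ht⟩ := (CLDQuery.mem_allData_reachablePart W).1 ht
  exact ⟨t, (CLDQuery.mem_allData_reachablePart _).2
    ⟨e, he.addData W d T, W.data_subset_addData d T e ht⟩, hμ⟩

theorem expandWord_addData {A : Type} {w : List (TapeSym A)}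
    (h : ∀ u, HasBinarySuffix w (encId L u) → W.adoc u ≠ some d) :
    expandWord I L (W.addData d T).enc w = expandWord I L W.enc w := by
  have : (fun x => IsLookup I L (W.addData d T).enc w x) = fun x => IsLookup I L W.enc w x := by
    funext x
    rw [isLookup_enc_iff, isLookup_enc_iff, eq_iff_iff]
    have henc : ∀ e, e ≠ d → (W.addData d T).encDoc e = W.encDoc e := fun e he => by
      exact congrArg encTriples (W.addData_data_of_ne d T he)
    constructor
    · rintro ⟨u, e, hw, he, rfl⟩
      exact ⟨u, e, hw, he, henc e fun hd => h u hw (he.trans (congrArg some hd))⟩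
    · rintro ⟨u, e, hw, he, rfl⟩
      exact ⟨u, e, hw, he, (henc e fun hd => h u hw (he.trans (congrArg some hd))).symm⟩
  -- The appended word is chosen from the look-up predicate alone, so equal predicates give equal
  -- words, including the choice.
  exact congrArg (fun p : List Sym → Prop => (@dite _ (∃ x, p x) (Classical.propDecidable _)
    (fun h => h.choose) fun _ => []) ++ [Sym.sharp]) this

/-- A step consults at most one document, since the word on the link traversal tape has at most one
identifier code as maximal binary suffix. -/
theorem LDMachine.exists_finite_step_addData (M : LDMachine) (κ : Config M.Q M.A) :
    ∃ F : Set W.D, F.Finite ∧ ∀ d ∉ F, ∀ T,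
      M.step I L (W.addData d T).enc [] κ = M.step I L W.enc [] κ := by
  refine ⟨{d | ∃ u, HasBinarySuffix (tapeWord κ.link) (encId L u) ∧ W.adoc u = some d}, ?_, ?_⟩
  · refine Set.Subsingleton.finite ?_
    rintro d ⟨u, hu, hd⟩ d' ⟨u', hu', hd'⟩
    cases hu.unique hu'
    exact Option.some.inj (hd.symm.trans hd')
  · intro d hd T
    have : κ.expand I L (W.addData d T).enc = κ.expand I L W.enc := by
      rw [Config.expand, Config.expand,
        expandWord_addData W d T fun u hu hud => hd ⟨u, hu, hud⟩]
    rw [LDMachine.step, LDMachine.step, this]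

theorem LDMachine.HaltsWith.exists_finite_addData {M : LDMachine} {out : List Sym}
    (h : M.HaltsWith I L W.enc [] out) :
    ∃ F : Set W.D, F.Finite ∧ ∀ d ∉ F, ∀ T, M.HaltsWith I L (W.addData d T).enc [] out := by
  obtain ⟨κ, hκ, hnone, rfl⟩ := h
  suffices H : ∀ κ₀, Reaches (M.step I L W.enc []) κ₀ κ → ∃ F : Set W.D, F.Finite ∧
      ∀ d ∉ F, ∀ T, Reaches (M.step I L (W.addData d T).enc []) κ₀ κ by
    obtain ⟨F, hF, h⟩ := H _ hκ
    obtain ⟨F', hF', h'⟩ := M.exists_finite_step_addData W κ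
    refine ⟨F ∪ F', hF.union hF', fun d hd T => ?_⟩
    rw [Set.mem_union, not_or] at hd
    exact ⟨κ, h d hd.1 T, (h' d hd.2 T).trans hnone, rfl⟩
  intro κ₀ h₀
  induction h₀ using ReflTransGen.head_induction_on with
  | refl => exact ⟨∅, Set.finite_empty, fun _ _ _ => ReflTransGen.refl⟩
  | @head κ₁ κ₂ h₁ _ ih =>
    obtain ⟨F, hF, h⟩ := ih
    obtain ⟨F', hF', h'⟩ := M.exists_finite_step_addData W κ₁
    refine ⟨F ∪ F', hF.union hF', fun d hd T => ?_⟩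
    rw [Set.mem_union, not_or] at hd
    exact ReflTransGen.head (by rw [h' d hd.2 T]; exact h₁) (h d hd.1 T)

theorem LDMachine.Computes.reachablePart_isFinite {M : LDMachine} {q : CLDQuery I L V}
    (hM : M.Computes q) (hP : (BQP.vars q.P).Nonempty) {W : Web I L} (hW : M.HaltsOn W) :
    (q.reachablePart W).IsFinite := by
  classical
  obtain ⟨out, hout⟩ := hW
  obtain ⟨F, hF, h⟩ := hout.exists_finite_addData W
  by_contra hinf
  have hinf' : {d | q.Reachable W d}.Infinite := hinf
  -- A reachable document on which the halting run does not depend.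
  obtain ⟨d, hd, hdF⟩ := (hinf'.sdiff hF).nonempty
  have henc := hM W out hout
  -- The result is finite because it has an encoding, whereas the constant valuations are infinitely
  -- many; this is where a variable is needed.
  obtain ⟨a, ha⟩ : ∃ a : I, constValuation L (BQP.vars q.P) a ∉ q.result W := by
    by_contra! hall
    exact (Set.infinite_range_of_injective (constValuation_injective hP)).mono
      (Set.range_subset_iff.2 hall) henc.finite
  let T : Finset (DataTriple I L) := q.P.image (TriplePattern.constTriple a)
  refine ha (henc.eq_of_subset (hM _ out (h d hdF T)) (q.result_subset_addData W d T) ⟨?_, ?_⟩)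
  · intro v
    simp [constValuation]
  · intro tp htp
    refine ⟨tp.constTriple a, (CLDQuery.mem_allData_reachablePart _).2 ⟨d, ?_, ?_⟩,
      constValuation_subst htp a⟩
    · exact CLDQuery.Reachable.addData W d T hd
    · exact W.subset_addData d T (Finset.mem_image_of_mem _ htp)

end AddData

end LinkedData


namespace LinkedData

/-! ## Computability of the encodings -/

noncomputable instance : Primcodable Sym := Primcodable.ofEquiv _ (Fintype.equivFin Sym)

noncomputable instance : Primcodable Cmd := Primcodable.ofEquiv _ (Fintype.equivFin Cmd)

section General

variable {α β : Type*} [Primcodable α] [Primcodable β]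

theorem Computable.list_find? {f : α → List β} {p : α → β → Bool} (hf : Computable f)
    (hp : Computable₂ p) : Computable fun a => (f a).find? (p a) := by
  have h : Computable fun a => Nat.rec (motive := fun _ => Option β) none
      (fun n o => Option.casesOn o ((f a)[n]?.bind fun b => bif p a b then some b else none) some)
      (f a).length := by
    refine Computable.nat_rec (h := fun a (x : ℕ × Option β) => Option.casesOn x.2
      ((f a)[x.1]?.bind fun b => bif p a b then some b else none) some)
      (Computable.list_length.comp hf) (Computable.const none) ?_
    refine Computable.option_casesOn (Computable.snd.comp Computable.snd) ?_
      (Computable.option_some.comp Computable.snd).to₂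
    refine Computable.option_bind (Computable.list_getElem?.comp (hf.comp Computable.fst)
      (Computable.fst.comp Computable.snd)) ?_
    exact (Computable.cond (hp.comp (Computable.fst.comp Computable.fst) Computable.snd)
      (Computable.option_some.comp Computable.snd) (Computable.const none)).to₂
  refine h.of_eq fun a => ?_
  -- After `n` rounds the accumulator holds the first hit among the first `n` entries.
  suffices H : ∀ n ≤ (f a).length, Nat.rec (motive := fun _ => Option β) none
      (fun n o => Option.casesOn o ((f a)[n]?.bind fun b => bif p a b then some b else none) some)
      n = ((f a).take n).find? (p a) by
    rw [H _ le_rfl, List.take_length]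
  intro n hn
  induction n with
  | zero => simp
  | succ n ih =>
    simp only [ih (by omega)]
    rw [List.take_add_one, List.find?_append, List.getElem?_eq_getElem (by omega)]
    cases ((f a).take n).find? (p a) with
    | some b => simp
    | none =>
      cases h : p a (f a)[n] <;> simp [h]

/-- Course-of-values recursion: the digits of `n` are its parity followed by the digits of `n.div2`,
found at that index in the table of earlier values. -/
theorem Primrec.nat_bits : Primrec Nat.bits := by
  refine (Primrec.nat_strong_rec (α := Unit) (fun _ n => n.bits)
    (g := fun _ l => some (if l.length = 0 then [] else
      l.length.bodd :: (l[l.length.div2]?).getD [])) ?_ ?_).comp (Primrec.const ()) Primrec.id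
  · refine Primrec.option_some.comp (Primrec.ite (Primrec.eq.comp
      (Primrec.list_length.comp Primrec.snd) (Primrec.const 0)) (Primrec.const []) ?_)
    exact Primrec.list_cons.comp (Primrec.nat_bodd.comp (Primrec.list_length.comp Primrec.snd))
      (Primrec.option_getD.comp (Primrec.list_getElem?.comp Primrec.snd
        (Primrec.nat_div2.comp (Primrec.list_length.comp Primrec.snd))) (Primrec.const []))
  · intro _ n
    simp only [List.length_map, List.length_range, Option.some.injEq]
    split_ifs with h
    · simp [h]
    · have hlt : n.div2 < n := Nat.binaryRec_decreasing h
      rw [List.getElem?_map, List.getElem?_range hlt, Option.map_some, Option.getD_some]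
      conv_rhs => rw [← Nat.bit_bodd_div2 n]
      rw [Nat.bits_append_bit]
      intro h0
      by_contra hb
      apply h
      rw [← Nat.bit_bodd_div2 n, h0]
      simp [Bool.not_eq_true] at hb
      simp [hb]

theorem Primrec.intercalate_singleton (s : β) {f : α → List (List β)} (hf : Primrec f) :
    Primrec fun a => [s].intercalate (f a) := by
  refine (Primrec.list_casesOn (g := fun _ => []) (h := fun _ x =>
    x.1 ++ x.2.flatMap fun y => [s] ++ y) hf (Primrec.const []) ?_).of_eq fun a => ?_
  · exact Primrec.list_append.comp (Primrec.fst.comp Primrec.snd)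
      (Primrec.list_flatMap (Primrec.snd.comp Primrec.snd)
        (Primrec.list_append.comp (Primrec.const [s]) Primrec.snd).to₂)
  · cases h : f a with
    | nil => simp [List.intercalate]
    | cons x l => simp only [intercalate_singleton_cons]

end General

section Encoding

variable {I L V : Type} [Denumerable I] [Denumerable L] [Denumerable V]

theorem primrec_encBin {α : Type} [Denumerable α] : Primrec (encBin : α → List Sym) :=
  Primrec.list_map (Primrec.nat_bits.comp (Primrec.succ.comp Primrec.encode))
    ((Primrec.dom_finite Sym.bit).comp Primrec.snd).to₂

theorem primrec_encTerm : Primrec (encTerm : I ⊕ L → List Sym) := primrec_encBin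

theorem primrec_encId : Primrec (encId L : I → List Sym) :=
  primrec_encTerm.comp Primrec.sumInl

theorem primrec_encTriple : Primrec (encTriple : DataTriple I L → List Sym) := by
  have h₂ : Primrec fun t : DataTriple I L => t.2.1 := Primrec.fst.comp Primrec.snd
  have h₃ : Primrec fun t : DataTriple I L => t.2.2 := Primrec.snd.comp Primrec.snd
  refine Primrec.list_append.comp (Primrec.list_append.comp (Primrec.list_append.comp
    (Primrec.list_append.comp (Primrec.list_append.comp (Primrec.list_append.comp
      (Primrec.const _) (primrec_encId.comp Primrec.fst)) (Primrec.const _))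
      (primrec_encId.comp h₂)) (Primrec.const _)) (primrec_encTerm.comp h₃)) (Primrec.const _)

theorem primrec_encTripleList : Primrec (encTripleList : List (DataTriple I L) → List Sym) := by
  refine Primrec.list_append.comp (Primrec.list_append.comp (Primrec.const _) ?_) (Primrec.const _)
  exact Primrec.intercalate_singleton _
    (Primrec.list_map Primrec.id (primrec_encTriple.comp Primrec.snd).to₂)

/-! ### Numerical codes of words and commands -/

open Driver

theorem primrec_two_pow : Primrec fun n : ℕ => 2 ^ n := by
  refine (Primrec.nat_rec₁ (f := fun _ m => 2 * m) 1
    (Primrec.nat_mul.comp (Primrec.const 2) Primrec.snd).to₂).of_eq fun n => ?_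
  induction n with
  | zero => rfl
  | succ n ih => simp only [ih, pow_succ']

theorem primrec_wordNum : Primrec wordNum := by
  refine Primrec.list_foldl (h := fun (_ : List Sym) (x : ℕ × Sym) =>
    snocUnary x.1 x.2.code) Primrec.id
    (Primrec.const 1) ?_
  exact Primrec.succ.comp (Primrec.nat_mul.comp (Primrec.const 2) (Primrec.nat_mul.comp
    (primrec_two_pow.comp ((Primrec.dom_finite Sym.code).comp (Primrec.snd.comp Primrec.snd)))
    (Primrec.fst.comp Primrec.snd)))

theorem primrec_num : Primrec₂ Cmd.num :=
  Primrec.nat_mul.comp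
    (primrec_two_pow.comp ((Primrec.dom_finite Cmd.code).comp Primrec.fst))
    (Primrec.succ.comp (Primrec.nat_mul.comp (Primrec.const 2) Primrec.snd))

/-- The exponent is the 2-adic valuation and the odd part is `n`; oddness is available because every
word code ends in the digit 1. -/
theorem snocUnary_inj {n n' k k' : ℕ} (hn : n % 2 = 1) (hn' : n' % 2 = 1)
    (h : snocUnary n k = snocUnary n' k') : n = n' ∧ k = k' := by
  have h : 2 ^ k * n = 2 ^ k' * n' := by
    simp only [snocUnary] at h
    omega
  have key : ∀ {n n' k k' : ℕ}, n % 2 = 1 → 2 ^ k * n = 2 ^ k' * n' → k' ≤ k := by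
    intro n n' k k' hn h
    by_contra! hlt
    obtain ⟨j, rfl⟩ := Nat.exists_eq_add_of_lt hlt
    rw [pow_succ, pow_add, mul_assoc, mul_assoc] at h
    have := Nat.eq_of_mul_eq_mul_left (by positivity) h
    rw [this, ← mul_assoc, mul_comm _ 2, mul_assoc] at hn
    omega
  obtain rfl := le_antisymm (key hn' h.symm) (key hn h)
  exact ⟨Nat.eq_of_mul_eq_mul_left (by positivity) h, rfl⟩

theorem wordNum_concat (r : List Sym) (s : Sym) :
    wordNum (r ++ [s]) = snocUnary (wordNum r) s.code := by
  simp [wordNum]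

theorem wordNum_odd (r : List Sym) : wordNum r % 2 = 1 := by
  cases r using List.reverseRecOn with
  | nil => rfl
  | append_singleton r s =>
    rw [wordNum_concat, snocUnary]
    omega

theorem wordNum_ne_one (r : List Sym) (s : Sym) : wordNum (r ++ [s]) ≠ 1 := by
  rw [wordNum_concat, snocUnary]
  have : 0 < 2 ^ s.code * wordNum r := by
    have := wordNum_odd r
    have : 0 < wordNum r := by omega
    positivity
  omega

theorem wordNum_injective : Function.Injective wordNum := by
  intro r r' h
  induction r using List.reverseRecOn generalizing r' with
  | nil =>
    cases r' using List.reverseRecOn with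
    | nil => rfl
    | append_singleton r' s => exact absurd h.symm (wordNum_ne_one r' s)
  | append_singleton r s ih =>
    cases r' using List.reverseRecOn with
    | nil => exact absurd h (wordNum_ne_one r s)
    | append_singleton r' s' =>
      rw [wordNum_concat, wordNum_concat] at h
      obtain ⟨h₁, h₂⟩ := snocUnary_inj (wordNum_odd r) (wordNum_odd r') h
      rw [ih h₁, Sym.code_injective h₂]

end Encoding

end LinkedData


namespace LinkedData

/-! ## Evaluation of the query over a finite list of triples -/

open Driver

theorem primrec_list_dedup {α : Type} [Primcodable α] [DecidableEq α] :
    Primrec (List.dedup : List α → List α) := by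
  have h : PrimrecPred fun x : α × List α => ∀ b ∈ x.2, x.1 ≠ b :=
    (((PrimrecRel.forall_mem_list (Primrec.eq.comp₂ Primrec₂.right Primrec₂.left).not).comp
      Primrec.snd Primrec.fst).of_eq fun x => Iff.rfl)
  exact Primrec.list_foldr (h := fun (_ : List α) (x : α × List α) =>
    if ∀ b ∈ x.2, x.1 ≠ b then x.1 :: x.2 else x.2) Primrec.id (Primrec.const [])
    (Primrec.ite (h.comp Primrec.snd) (Primrec.list_cons.comp (Primrec.fst.comp Primrec.snd)
      (Primrec.snd.comp Primrec.snd)) (Primrec.snd.comp Primrec.snd))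

/-- All association lists with the given keys and with values from a list. -/
def assignments {K A : Type} : List K → List A → List (List (K × A))
  | [], _ => [[]]
  | x :: xs, as => as.flatMap fun a => (assignments xs as).map fun p => (x, a) :: p

section Assignments

variable {K A : Type}

theorem primrec_assignments [Primcodable K] [Primcodable A] (xs : List K) :
    Primrec (assignments xs : List A → List (List (K × A))) := by
  induction xs with
  | nil => exact Primrec.const _
  | cons x xs ih =>
    refine Primrec.list_flatMap (g := fun as a => (assignments xs as).map fun p => (x, a) :: p)
      Primrec.id ?_
    refine Primrec.list_map (ih.comp Primrec.fst) ?_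
    exact Primrec.list_cons.comp (Primrec.pair (Primrec.const x) (Primrec.snd.comp Primrec.fst))
      Primrec.snd

theorem mem_assignments_cons {x : K} {xs : List K} {as : List A} {p : List (K × A)} :
    p ∈ assignments (x :: xs) as ↔ ∃ a ∈ as, ∃ p' ∈ assignments xs as, p = (x, a) :: p' := by
  simp [assignments, eq_comm]

theorem nodup_assignments (xs : List K) {as : List A} (h : as.Nodup) :
    (assignments xs as).Nodup := by
  induction xs with
  | nil => simp [assignments]
  | cons x xs ih =>
    refine List.nodup_flatMap.2 ⟨fun a _ => ih.map fun p p' hp => (List.cons.inj hp).2, ?_⟩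
    refine h.imp fun {a b} hab => ?_
    simp only [Function.onFun, List.disjoint_left, List.mem_map, not_exists, not_and]
    rintro _ ⟨p, _, rfl⟩ p' _ hp
    exact hab (Prod.mk.inj (List.cons.inj hp).1).2.symm

variable [DecidableEq K]

theorem lookup_isSome_of_mem_assignments {xs : List K} {as : List A} {p : List (K × A)}
    (hp : p ∈ assignments xs as) (v : K) : (p.lookup v).isSome ↔ v ∈ xs := by
  induction xs generalizing p with
  | nil => simp_all [assignments]
  | cons x xs ih =>
    obtain ⟨a, _, p', hp', rfl⟩ := mem_assignments_cons.1 hp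
    by_cases h : v = x
    · simp [h]
    · simp [List.lookup_cons, beq_false_of_ne h, h, ih hp']

/-- Distinct keys matter: `lookup` sees only the first entry for a key. With them, distinct
association lists are distinct valuations, so no solution is printed twice. -/
theorem eq_of_mem_assignments {xs : List K} (hxs : xs.Nodup) {as : List A} {p p' : List (K × A)}
    (hp : p ∈ assignments xs as) (hp' : p' ∈ assignments xs as)
    (h : ∀ v ∈ xs, p.lookup v = p'.lookup v) : p = p' := by
  induction xs generalizing p p' with
  | nil => simp_all [assignments]
  | cons x xs ih =>
    obtain ⟨a, _, r, hr, rfl⟩ := mem_assignments_cons.1 hp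
    obtain ⟨b, _, r', hr', rfl⟩ := mem_assignments_cons.1 hp'
    obtain ⟨hx, hxs⟩ := List.nodup_cons.1 hxs
    have hab := h x List.mem_cons_self
    simp only [List.lookup_cons_self, Option.some.injEq] at hab
    rw [hab, ih hxs hr hr' fun v hv => ?_]
    have hv' := h v (List.mem_cons_of_mem _ hv)
    have hne : v ≠ x := fun h => hx (h ▸ hv)
    simpa [List.lookup_cons, beq_false_of_ne hne] using hv'

theorem exists_mem_assignments {xs : List K} (hxs : xs.Nodup) {as : List A} {μ : K → Option A}
    (h : ∀ v ∈ xs, ∃ a ∈ as, μ v = some a) :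
    ∃ p ∈ assignments xs as, ∀ v ∈ xs, p.lookup v = μ v := by
  induction xs with
  | nil => simp [assignments]
  | cons x xs ih =>
    obtain ⟨hx, hxs⟩ := List.nodup_cons.1 hxs
    obtain ⟨p, hp, hpv⟩ := ih hxs fun v hv => h v (List.mem_cons_of_mem _ hv)
    obtain ⟨a, ha, hμ⟩ := h x List.mem_cons_self
    refine ⟨(x, a) :: p, mem_assignments_cons.2 ⟨a, ha, p, hp, rfl⟩, fun v hv => ?_⟩
    rcases List.mem_cons.1 hv with rfl | hv
    · simp [hμ]
    · have hne : v ≠ x := fun h => hx (h ▸ hv)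
      simpa [List.lookup_cons, beq_false_of_ne hne] using hpv v hv

end Assignments

/-- The components of a data triple. -/
def DataTriple.terms {I L : Type} (t : DataTriple I L) : List (I ⊕ L) :=
  [Sum.inl t.1, Sum.inl t.2.1, t.2.2]

theorem Valuation.mem_terms_of_subst {I L V : Type} {μ : Valuation I L V}
    {tp : TriplePattern I L V} {t : DataTriple I L}
    (h : μ.subst tp = some (Sum.inl t.1, Sum.inl t.2.1, t.2.2)) {v : V} (hv : tp.HasVar v) :
    ∃ a ∈ t.terms, μ v = some a := by
  obtain ⟨s, p, o⟩ := tp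
  simp only [Valuation.subst, Option.bind_eq_some_iff, Option.map_eq_some_iff,
    Prod.mk.injEq] at h
  obtain ⟨s', hs, p', hp, o', ho, rfl, rfl, rfl⟩ := h
  rcases hv with hv | hv | hv <;> simp only at hv <;> subst hv
  · exact ⟨_, by simp [DataTriple.terms], hs⟩
  · exact ⟨_, by simp [DataTriple.terms], hp⟩
  · exact ⟨_, by simp [DataTriple.terms], ho⟩

namespace CLDQuery

variable {I L V : Type} [Denumerable I] [Denumerable L] [Denumerable V] (q : CLDQuery I L V)

attribute [local instance] Encodable.decidableEqOfEncodable

/-- The association list, read as a valuation, maps every triple pattern of the query to a triple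
of the list. -/
def Satisfies (p : List (V × (I ⊕ L))) (known : List (DataTriple I L)) : Prop :=
  ∀ tp ∈ q.P.toList, ∃ t ∈ known,
    Valuation.subst (fun v => p.lookup v) tp = some (Sum.inl t.1, Sum.inl t.2.1, t.2.2)

theorem primrec_subst (tp : TriplePattern I L V) :
    Primrec fun p : List (V × (I ⊕ L)) => Valuation.subst (fun v => p.lookup v) tp := by
  have h (v : V) : Primrec fun p : List (V × (I ⊕ L)) => p.lookup v :=
    Primrec.listLookup.comp (Primrec.const v) Primrec.id
  obtain ⟨s, p, o⟩ := tp
  refine Primrec.option_bind (α := List (V × (I ⊕ L))) (β := I ⊕ L)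
    (σ := (I ⊕ L) × (I ⊕ L) × (I ⊕ L)) ?_ (Primrec.option_bind
      (α := List (V × (I ⊕ L)) × (I ⊕ L)) (β := I ⊕ L)
    (σ := (I ⊕ L) × (I ⊕ L) × (I ⊕ L)) ?_ (Primrec.option_map ?_ ?_))
  · cases s with
    | inl v => exact h v
    | inr u => exact Primrec.const _
  · cases p with
    | inl v => exact (h v).comp Primrec.fst
    | inr u => exact Primrec.const _
  · cases o with
    | inl v => exact (h v).comp (Primrec.fst.comp Primrec.fst)
    | inr u => exact Primrec.const _
  · exact Primrec.pair (Primrec.snd.comp (Primrec.fst.comp Primrec.fst))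
      (Primrec.pair (Primrec.snd.comp Primrec.fst) Primrec.snd)

theorem primrec_satisfies : PrimrecRel q.Satisfies := by
  unfold Satisfies
  induction q.P.toList with
  | nil => exact (PrimrecPred.of_eq (p := fun _ => 0 = 0)
      (Primrec.eq.comp (Primrec.const 0) (Primrec.const 0)) fun _ => by simp)
  | cons tp l ih =>
    have h : PrimrecRel fun (t : DataTriple I L) (p : List (V × (I ⊕ L))) =>
        Valuation.subst (fun v => p.lookup v) tp = some (Sum.inl t.1, Sum.inl t.2.1, t.2.2) :=
      Primrec.eq.comp ((primrec_subst tp).comp Primrec.snd)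
        (Primrec.option_some.comp (Primrec.pair (Primrec.sumInl.comp
          (Primrec.fst.comp Primrec.fst)) (Primrec.pair (Primrec.sumInl.comp (Primrec.fst.comp
            (Primrec.snd.comp Primrec.fst))) (Primrec.snd.comp (Primrec.snd.comp Primrec.fst)))))
    exact (((PrimrecRel.exists_mem_list h).comp Primrec.snd Primrec.fst).and ih).of_eq fun x => by
      simp

open Classical in
/-- The valuations of the query result over a list of triples, as association lists. -/
noncomputable def solutions (known : List (DataTriple I L)) : List (List (V × (I ⊕ L))) :=
  (assignments (sorted (BQP.vars q.P)) (known.flatMap DataTriple.terms).dedup).filter fun p =>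
    q.Satisfies p known

/-- An encoding of the query result over a list of triples. -/
noncomputable def resultWord (known : List (DataTriple I L)) : List Sym :=
  (q.solutions known).flatMap fun p =>
    encValuation (BQP.vars q.P) fun v => p.lookup v

theorem primrec_resultWord : Primrec q.resultWord := by
  classical
  have hterms : Primrec (DataTriple.terms : DataTriple I L → List (I ⊕ L)) :=
    Primrec.list_cons.comp (Primrec.sumInl.comp Primrec.fst) (Primrec.list_cons.comp
      (Primrec.sumInl.comp (Primrec.fst.comp Primrec.snd)) (Primrec.list_cons.comp
        (Primrec.snd.comp Primrec.snd) (Primrec.const [])))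
  refine Primrec.list_flatMap ?_ ?_
  · exact (PrimrecRel.listFilter q.primrec_satisfies).comp ((primrec_assignments _).comp
      (primrec_list_dedup.comp (Primrec.list_flatMap Primrec.id (hterms.comp Primrec.snd).to₂)))
      Primrec.id
  · refine Primrec.list_append.comp (Primrec.list_append.comp (Primrec.const _)
      (Primrec.intercalate_singleton _ (Primrec.list_map (Primrec.const _) ?_))) (Primrec.const _)
    refine Primrec.list_append.comp (Primrec.list_append.comp (primrec_encBin.comp Primrec.snd)
      (Primrec.const _)) (Primrec.option_getD.comp (Primrec.option_map (Primrec.listLookup.comp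
        Primrec.snd (Primrec.snd.comp Primrec.fst)) (primrec_encTerm.comp Primrec.snd).to₂)
          (Primrec.const []))

/-- The brute-force search is complete because each variable occurs in some pattern, so a solution
must map it to a component of a known triple. -/
theorem isEncoding_resultWord (W : Web I L) {known : List (DataTriple I L)}
    (h : ∀ t, t ∈ known ↔ t ∈ (q.reachablePart W).allData) :
    IsEncoding (BQP.vars q.P) (q.result W) (q.resultWord known) := by
  classical
  have hxs : (sorted (BQP.vars q.P)).Nodup := Finset.sort_nodup _ _
  have hmem (v : V) : v ∈ sorted (BQP.vars q.P) ↔ v ∈ BQP.vars q.P := Finset.mem_sort _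
  refine ⟨(q.solutions known).map fun p v => p.lookup v, ?_, fun μ => ?_, ?_⟩
  · refine List.Nodup.map_on (fun p hp p' hp' hpp' => ?_)
      ((nodup_assignments _ (List.nodup_dedup _)).filter _)
    exact eq_of_mem_assignments hxs (List.mem_filter.1 hp).1 (List.mem_filter.1 hp').1
      fun v _ => congrFun hpp' v
  · simp only [List.mem_map, solutions, List.mem_filter, decide_eq_true_eq]
    constructor
    · rintro ⟨p, ⟨hp, hsat⟩, rfl⟩
      refine ⟨fun v => (lookup_isSome_of_mem_assignments hp v).trans (hmem v), fun tp htp => ?_⟩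
      obtain ⟨t, ht, hs⟩ := hsat tp (Finset.mem_toList.2 htp)
      exact ⟨t, (h t).1 ht, hs⟩
    · rintro ⟨hdom, hsat⟩
      obtain ⟨p, hp, hpv⟩ := exists_mem_assignments (μ := μ) hxs
        (as := (known.flatMap DataTriple.terms).dedup) fun v hv => by
          obtain ⟨tp, htp, hv⟩ := (BQP.mem_vars _ _).1 ((hmem v).1 hv)
          obtain ⟨t, ht, hs⟩ := hsat tp htp
          obtain ⟨a, ha, hμ⟩ := Valuation.mem_terms_of_subst hs hv
          exact ⟨a, List.mem_dedup.2 (List.mem_flatMap.2 ⟨t, (h t).2 ht, ha⟩), hμ⟩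
      have hμ : (fun v => p.lookup v) = μ := by
        funext v
        by_cases hv : v ∈ sorted (BQP.vars q.P)
        · exact hpv v hv
        · rw [Option.not_isSome_iff_eq_none.1 fun h =>
            hv ((lookup_isSome_of_mem_assignments hp v).1 h),
            Option.not_isSome_iff_eq_none.1 fun h => hv ((hmem v).2 ((hdom v).1 h))]
      refine ⟨p, ⟨hp, fun tp htp => ?_⟩, hμ⟩
      obtain ⟨t, ht, hs⟩ := hsat tp (Finset.mem_toList.1 htp)
      exact ⟨t, (h t).2 ht, by rw [hμ, hs]⟩
  · rw [List.flatMap_map]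
    rfl

end CLDQuery

end LinkedData


namespace LinkedData

/-! ## The program -/

open Driver

/-- The answer of the expand procedure, if any, from which a list of triples is to be read. -/
def IsResponse {I L : Type} [Denumerable I] [Denumerable L] (r : List Sym)
    (T : List (DataTriple I L)) : Prop :=
  r = encTripleList T ++ [Sym.sharp] ∨ T = [] ∧ (r = [] ∨ r = [Sym.sharp])

section Parse

variable {I L : Type} [Denumerable I] [Denumerable L]

theorem IsResponse.unique {r : List Sym} {T T' : List (DataTriple I L)} (h : IsResponse r T)
    (h' : IsResponse r T') : T = T' := by
  have key : ∀ T : List (DataTriple I L), encTripleList T ≠ [] := by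
    simp [encTripleList]
  rcases h with rfl | ⟨rfl, h⟩ <;> rcases h' with h' | ⟨rfl, h'⟩
  · exact encTripleList_injective (List.append_cancel_right h')
  · simp [key] at h'
  · subst h'
    simp [key] at h
  · rfl

open Classical in
/-- Read a list of triples from the number of a response, by search. -/
noncomputable def parse (I L : Type) [Denumerable I] [Denumerable L] (r : ℕ) :
    Part (List (DataTriple I L)) :=
  Nat.rfindOpt fun k => (Encodable.decode k : Option (List (DataTriple I L))).bind fun T =>
    if wordNum (encTripleList T ++ [Sym.sharp]) = r ∨
      T = [] ∧ (wordNum [] = r ∨ wordNum [Sym.sharp] = r) then some T else none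

theorem IsResponse.mem_parse {r : List Sym} {T : List (DataTriple I L)} (h : IsResponse r T) :
    T ∈ parse I L (wordNum r) := by
  have hiff (T : List (DataTriple I L)) : (wordNum (encTripleList T ++ [Sym.sharp]) = wordNum r ∨
      T = [] ∧ (wordNum [] = wordNum r ∨ wordNum [Sym.sharp] = wordNum r)) ↔ IsResponse r T := by
    simp only [wordNum_injective.eq_iff, IsResponse, eq_comm]
  -- The search stops at the latest at the code of `T`; whatever it finds is `T` by uniqueness.
  have hdom : (parse I L (wordNum r)).Dom := Nat.rfindOpt_dom.2 ⟨Encodable.encode T, T, by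
    rw [Encodable.encodek, Option.bind_some, if_pos ((hiff T).2 h), Option.mem_some_iff]⟩
  obtain ⟨T', hT'⟩ := Part.dom_iff_mem.1 hdom
  obtain ⟨k, hk⟩ := Nat.rfindOpt_spec hT'
  obtain ⟨T'', _, hT''⟩ := Option.bind_eq_some_iff.1 hk
  split_ifs at hT'' with h''
  obtain rfl := Option.some.inj hT''
  rwa [h.unique ((hiff _).1 h'')]

theorem partrec_parse : Partrec (parse I L) := by
  classical
  have hw : Primrec fun T : List (DataTriple I L) => wordNum (encTripleList T ++ [Sym.sharp]) :=
    primrec_wordNum.comp (Primrec.list_append.comp primrec_encTripleList (Primrec.const _))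
  refine Partrec.rfindOpt (f := fun r k =>
    (Encodable.decode k : Option (List (DataTriple I L))).bind fun T =>
    if wordNum (encTripleList T ++ [Sym.sharp]) = r ∨
      T = [] ∧ (wordNum [] = r ∨ wordNum [Sym.sharp] = r) then some T else none)
    (Primrec.to_comp ?_)
  have hr : Primrec fun x : (ℕ × ℕ) × List (DataTriple I L) => x.1.1 :=
    Primrec.fst.comp Primrec.fst
  refine Primrec.option_bind (Primrec.decode.comp Primrec.snd) (Primrec.ite
    (PrimrecPred.or (Primrec.eq.comp (hw.comp Primrec.snd) hr)
      (PrimrecPred.and (Primrec.eq.comp Primrec.snd (Primrec.const []))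
        (PrimrecPred.or (Primrec.eq.comp (Primrec.const _) hr)
          (Primrec.eq.comp (Primrec.const _) hr))))
    (Primrec.option_some.comp Primrec.snd) (Primrec.const none))

end Parse

/-- The identifiers of a data triple. -/
def DataTriple.ids {I L : Type} (t : DataTriple I L) : List I :=
  [t.1, t.2.1] ++ t.2.2.elim (fun u => [u]) fun _ => []

theorem DataTriple.mem_ids {I L : Type} {t : DataTriple I L} {u : I} :
    u ∈ t.ids ↔ t.HasId u := by
  obtain ⟨a, b, c | c⟩ := t <;> simp [ids, HasId]

namespace CLDQuery

variable {I L V : Type} [Denumerable I] [Denumerable L] [Denumerable V] (q : CLDQuery I L V)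

attribute [local instance] Encodable.decidableEqOfEncodable

/-- The identifier is a seed or its look-up is licensed by a triple of the list. -/
def Licensed (known : List (DataTriple I L)) (u : I) : Prop :=
  u ∈ q.S ∨ ∃ t ∈ known, t.HasId u ∧ q.c.toFun t u q.P = true

/-- The seeds and the identifiers in a list of triples, with their origins. -/
noncomputable def origins (known : List (DataTriple I L)) : List (Option (DataTriple I L) × I) :=
  q.S.toList.map (fun u => (none, u)) ++
    known.flatMap fun t => t.ids.map fun u => (some t, u)

/-- An identifier that is to be looked up next. -/
noncomputable def nextId (known : List (DataTriple I L)) (visited : List I) : Option I :=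
  ((q.origins known).find? fun x =>
    (Option.casesOn x.1 true fun t => q.c.toFun t x.2 q.P) && decide (x.2 ∉ visited)).map Prod.snd

theorem nextId_eq_some {known : List (DataTriple I L)} {visited : List I} {u : I}
    (h : q.nextId known visited = some u) : q.Licensed known u ∧ u ∉ visited := by
  obtain ⟨⟨o, u'⟩, hx, rfl⟩ := Option.map_eq_some_iff.1 h
  have hmem := List.mem_of_find?_eq_some hx
  have hp := List.find?_some hx
  simp only [Bool.and_eq_true, decide_eq_true_eq] at hp
  refine ⟨?_, hp.2⟩
  rcases List.mem_append.1 hmem with hmem | hmem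
  · obtain ⟨v, hv, heq⟩ := List.mem_map.1 hmem
    obtain ⟨-, rfl⟩ := Prod.mk.inj heq
    exact Or.inl (Finset.mem_toList.1 hv)
  · obtain ⟨t, ht, hmem⟩ := List.mem_flatMap.1 hmem
    obtain ⟨v, hv, heq⟩ := List.mem_map.1 hmem
    obtain ⟨rfl, rfl⟩ := Prod.mk.inj heq
    exact Or.inr ⟨t, ht, DataTriple.mem_ids.1 hv, hp.1⟩

theorem mem_of_nextId_eq_none {known : List (DataTriple I L)} {visited : List I}
    (h : q.nextId known visited = none) {u : I} (hu : q.Licensed known u) : u ∈ visited := by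
  have h := List.find?_eq_none.1 (Option.map_eq_none_iff.1 h)
  by_contra hv
  rcases hu with hu | ⟨t, ht, hid, hc⟩
  · refine h (none, u) (List.mem_append_left _ (List.mem_map.2 ⟨u, Finset.mem_toList.2 hu, rfl⟩)) ?_
    simp [hv]
  · refine h (some t, u) (List.mem_append_right _ (List.mem_flatMap.2 ⟨t, ht, List.mem_map.2
      ⟨u, DataTriple.mem_ids.2 hid, rfl⟩⟩)) ?_
    simp [hv, hc]

/-- The criterion is computable but need not be primitive recursive, so from this point on only
computability is claimed. -/
theorem computable_nextId : Computable₂ q.nextId := by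
  classical
  have hids : Primrec (DataTriple.ids : DataTriple I L → List I) :=
    Primrec.list_append.comp (Primrec.list_cons.comp Primrec.fst (Primrec.list_cons.comp
      (Primrec.fst.comp Primrec.snd) (Primrec.const [])))
      ((Primrec.sumCasesOn (Primrec.snd.comp Primrec.snd) (Primrec.list_cons.comp Primrec.snd
        (Primrec.const [])).to₂ (Primrec.const []).to₂).of_eq fun t => by
          obtain ⟨_, _, _ | _⟩ := t <;> rfl)
  have horigins : Primrec q.origins := by
    refine Primrec.list_append.comp (Primrec.const _) (Primrec.list_flatMap Primrec.id ?_)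
    exact Primrec.list_map (hids.comp Primrec.snd) (Primrec.pair (Primrec.option_some.comp
      (Primrec.snd.comp Primrec.fst)) Primrec.snd).to₂
  have hmem : PrimrecRel fun (u : I) (l : List I) => u ∉ l :=
    ((PrimrecRel.exists_mem_list Primrec.eq).comp Primrec.snd Primrec.fst).not.of_eq
      fun x => by simp
  have hc : Computable₂ fun (t : DataTriple I L) (u : I) => q.c.toFun t u q.P :=
    (q.c.computable_toFun.comp (Computable.fst.pair (Computable.snd.pair
      (Computable.const q.P.toList)))).of_eq fun x => by simp
  refine Computable.option_map (Computable.list_find? (p := fun (y : List (DataTriple I L) × List I)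
    (x : Option (DataTriple I L) × I) => (Option.casesOn x.1 true fun t => q.c.toFun t x.2 q.P) &&
      decide (x.2 ∉ y.2)) (horigins.to_comp.comp Computable.fst) ?_)
    (Computable.snd.comp Computable.snd)
  refine Primrec.and.to_comp.comp (Computable.option_casesOn
    (Computable.fst.comp Computable.snd) (Computable.const true) ?_) ?_
  · exact hc.comp Computable.snd (Computable.snd.comp (Computable.snd.comp Computable.fst))
  · exact (hmem.decide.comp (Primrec.snd.comp Primrec.snd)
      (Primrec.snd.comp Primrec.fst)).to_comp

/-- The known triples, the visited identifiers, and the commands to be executed. -/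
abbrev Memory (I L : Type) : Type := List (DataTriple I L) × List I × List Cmd

/-- The commands to be executed next, and the visited identifiers after that. -/
noncomputable def plan (known : List (DataTriple I L)) (visited : List I) : List I × List Cmd :=
  Option.casesOn (q.nextId known visited)
    (visited, (q.resultWord known).map Cmd.emit ++ [Cmd.halt])
    fun u => (visited ++ [u], (encId L u).map Cmd.write ++ [Cmd.expand])

/-- The memory before the execution of the next command: add the triples that have been read, and
make a new plan if there are no commands left. -/
noncomputable def advance (T : List (DataTriple I L)) (m : Memory I L) : Memory I L :=
  (m.1 ++ T, if m.2.2 = [] then q.plan (m.1 ++ T) m.2.1 else m.2)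

/-- The program of the machine for the query: from the number of a response and the code of a
memory, compute a command together with the code of the new memory. -/
noncomputable def program (r m : ℕ) : Part ℕ :=
  (parse I L r).map fun T =>
    let m := q.advance T ((Encodable.decode m : Option (Memory I L)).getD ([], [], []))
    m.2.2.headI.num (Encodable.encode (m.1, m.2.1, m.2.2.tail))

theorem computable_plan : Computable₂ q.plan := by
  have h₁ : Primrec fun known => (q.resultWord known).map Cmd.emit ++ [Cmd.halt] :=
    Primrec.list_append.comp (Primrec.list_map q.primrec_resultWord
      ((Primrec.dom_finite Cmd.emit).comp Primrec.snd).to₂) (Primrec.const _)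
  have h₂ : Primrec fun u : I => (encId L u).map Cmd.write ++ [Cmd.expand] :=
    Primrec.list_append.comp (Primrec.list_map primrec_encId
      ((Primrec.dom_finite Cmd.write).comp Primrec.snd).to₂) (Primrec.const _)
  have h₃ : Primrec₂ fun (l : List I) (u : I) => l ++ [u] :=
    Primrec.list_append.comp Primrec.fst
      (Primrec.list_cons.comp Primrec.snd (Primrec.const []))
  have h₄ : Computable fun x : List (DataTriple I L) × List I =>
      (x.2, (q.resultWord x.1).map Cmd.emit ++ [Cmd.halt]) :=
    Computable.snd.pair (h₁.to_comp.comp Computable.fst)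
  have h₅ : Computable₂ fun (x : List (DataTriple I L) × List I) (u : I) =>
      (x.2 ++ [u], (encId L u).map Cmd.write ++ [Cmd.expand]) :=
    (h₃.to_comp.comp (Computable.snd.comp Computable.fst) Computable.snd).pair
      (h₂.to_comp.comp Computable.snd)
  exact (Computable.option_casesOn q.computable_nextId h₄ h₅).of_eq fun x => by
    rw [plan]

theorem computable_advance : Computable₂ q.advance := by
  have hT : Primrec fun x : List (DataTriple I L) × Memory I L => x.2.1 ++ x.1 :=
    Primrec.list_append.comp (Primrec.fst.comp Primrec.snd) Primrec.fst
  have hempty : PrimrecPred fun x : List (DataTriple I L) × Memory I L => x.2.2.2 = [] :=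
    Primrec.eq.comp (Primrec.snd.comp (Primrec.snd.comp Primrec.snd)) (Primrec.const [])
  refine hT.to_comp.pair ((Computable.cond hempty.decide.to_comp
    (q.computable_plan.comp hT.to_comp (Primrec.fst.comp (Primrec.snd.comp Primrec.snd)).to_comp)
    (Primrec.snd.comp Primrec.snd).to_comp).of_eq fun x => ?_)
  by_cases h : x.2.2.2 = [] <;> simp [h]

theorem partrec_program : Partrec₂ q.program := by
  refine Partrec.map (partrec_parse.comp Computable.fst) ?_
  have hm : Computable fun x : (ℕ × ℕ) × List (DataTriple I L) => q.advance x.2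
      ((Encodable.decode x.1.2 : Option (Memory I L)).getD ([], [], [])) :=
    q.computable_advance.comp Computable.snd (Primrec.option_getD.comp (Primrec.decode.comp
      (Primrec.snd.comp Primrec.fst)) (Primrec.const _)).to_comp
  have hn : Primrec fun m : Memory I L =>
      m.2.2.headI.num (Encodable.encode (m.1, m.2.1, m.2.2.tail)) := by
    have hq : Primrec fun m : Memory I L => m.2.2 := Primrec.snd.comp Primrec.snd
    exact primrec_num.comp (Primrec.list_headI.comp hq) (Primrec.encode.comp
      (Primrec.fst.pair ((Primrec.fst.comp Primrec.snd).pair (Primrec.list_tail.comp hq))))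
  exact hn.to_comp.comp hm

/-- The search in `parse` may diverge on arbitrary numbers, so the value is asserted only for codes
of genuine responses. -/
theorem exists_code : ∃ c : Turing.ToPartrec.Code, ∀ (r : List Sym) (T : List (DataTriple I L))
    (m : Memory I L), IsResponse r T →
      [(q.advance T m).2.2.headI.num (Encodable.encode
        (((q.advance T m).1, (q.advance T m).2.1, (q.advance T m).2.2.tail) : Memory I L))] ∈
      c.eval [wordNum r, Encodable.encode m] := by
  obtain ⟨c, hc⟩ := Turing.ToPartrec.Code.exists_code
    (Nat.Partrec'.part_iff₂.2 q.partrec_program)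
  refine ⟨c, fun r T m h => ?_⟩
  have hv := hc (wordNum r ::ᵥ Encodable.encode m ::ᵥ List.Vector.nil)
  simp only [List.Vector.head_cons, List.Vector.tail_cons] at hv
  change c.eval [wordNum r, Encodable.encode m] = _ at hv
  rw [hv]
  refine Part.mem_map_iff _ |>.2 ⟨_, Part.mem_map_iff _ |>.2 ⟨T, h.mem_parse, rfl⟩, ?_⟩
  simp

end CLDQuery

end LinkedData


namespace LinkedData

/-! ## The traversal -/

open Driver StateTransition

namespace CLDQuery

variable {I L V : Type} [Denumerable I] [Denumerable L] [Denumerable V] {q : CLDQuery I L V}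

variable (q) in
/-- The code computes the next command and memory of the program for the query. -/
def IsCode (c : Turing.ToPartrec.Code) : Prop :=
  ∀ (r : List Sym) (T : List (DataTriple I L)) (m m' : Memory I L) (a : Cmd),
    IsResponse r T → q.advance T m = (m'.1, m'.2.1, a :: m'.2.2) →
      [a.num (Encodable.encode m')] ∈ c.eval [wordNum r, Encodable.encode m]

theorem exists_isCode : ∃ c, q.IsCode c := by
  obtain ⟨c, hc⟩ := q.exists_code
  refine ⟨c, fun r T m m' a hr h => ?_⟩
  have := hc r T m hr
  rwa [h] at this

/-- The situation at the start and after an emit or write command, when nothing on the tape is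
unread. -/
theorem isResponse_nil : IsResponse [] ([] : List (DataTriple I L)) := Or.inr ⟨rfl, Or.inl rfl⟩

theorem advance_nil {m : Memory I L} (h : m.2.2 ≠ []) : q.advance [] m = m := by
  simp [advance, h]

variable {c : Turing.ToPartrec.Code} {known T : List (DataTriple I L)} {visited : List I}
  {web : SymTape} {w r out : List Sym} {m : Memory I L}

/-- Execution of the commands for looking up an identifier. -/
theorem IsCode.leads_expand (hc : q.IsCode c) (ss : List Sym) (hr : IsResponse r T)
    (h : q.advance T m = (known, visited, ss.map Cmd.write ++ [Cmd.expand])) :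
    Leads I L c web (ready c (Encodable.encode m) w r out)
      (ready c (Encodable.encode ((known, visited, []) : Memory I L)) (w ++ r ++ ss)
        (expandWord I L web ((w ++ r ++ ss).map fun s => some (Sum.inl (β := Cell) s))) out) := by
  induction ss generalizing m w r T with
  | nil =>
    rw [List.append_nil]
    exact leads_ready_expand (hc r T m (known, visited, []) _ hr h)
  | cons s ss ih =>
    refine (leads_ready_write (hc r T m (known, visited, ss.map Cmd.write ++ [Cmd.expand]) _
      hr h)).trans ?_
    have := ih (w := w ++ r ++ [s]) isResponse_nil (advance_nil (q := q)
      (m := (known, visited, ss.map Cmd.write ++ [Cmd.expand])) (by simp))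
    simpa using this

/-- Execution of the commands for the output. -/
theorem IsCode.reaches_halt (hc : q.IsCode c) (ss : List Sym) (hr : IsResponse r T)
    (h : q.advance T m = (known, visited, ss.map Cmd.emit ++ [Cmd.halt]))
    {κ : Config (State c) Cell} (hκ : κ ∈ ready c (Encodable.encode m) w r out) :
    ∃ κ', Reaches (next I L c web) κ κ' ∧ next I L c web κ' = none ∧ κ'.out = out ++ ss := by
  induction ss generalizing m w r T κ out with
  | nil =>
    rw [List.append_nil]
    exact reaches_ready_halt (hc r T m (known, visited, []) _ hr h) hκ
  | cons s ss ih =>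
    obtain ⟨κ₁, h₁, hr₁⟩ := leads_ready_emit (I := I) (L := L) (web := web)
      (hc r T m (known, visited, ss.map Cmd.emit ++ [Cmd.halt]) _ hr h) κ hκ
    obtain ⟨κ₂, h₂, hn, ho⟩ := ih isResponse_nil (advance_nil (q := q)
      (m := (known, visited, ss.map Cmd.emit ++ [Cmd.halt])) (by simp)) h₁
    exact ⟨κ₂, hr₁.to_reflTransGen.trans h₂, hn, by simpa using ho⟩

/-! ### The invariant -/

variable {W : Web I L}

/-- The identifiers that are looked up during the traversal of `W`. -/
def Candidate (q : CLDQuery I L V) (W : Web I L) (u : I) : Prop :=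
  u ∈ q.S ∨ ∃ d, q.Reachable W d ∧ ∃ t ∈ W.data d, t.HasId u ∧ q.c.toFun t u q.P = true

theorem Candidate.reachable {u : I} (hu : q.Candidate W u) {d : W.D} (hd : W.adoc u = some d) :
    q.Reachable W d := by
  rcases hu with hu | ⟨e, he, t, ht, hid, hc⟩
  · exact .seed u d hu hd
  · exact .link e d t u he ht hid hc hd

/-- Every candidate is a seed or occurs in one of the finitely many triples of the finitely many
reachable documents. -/
theorem finite_candidate (h : (q.reachablePart W).IsFinite) : {u | q.Candidate W u}.Finite := by
  have : Finite {d // q.Reachable W d} := h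
  refine ((q.S.finite_toSet).union (Set.finite_iUnion fun d : {d // q.Reachable W d} =>
    (W.data d.1).finite_toSet.biUnion fun t _ => t.ids.finite_toSet)).subset fun u hu => ?_
  rcases hu with hu | ⟨d, hd, t, ht, hid, -⟩
  · exact Or.inl hu
  · exact Or.inr (Set.mem_iUnion.2 ⟨⟨d, hd⟩, Set.mem_biUnion (Finset.mem_coe.2 ht)
      (DataTriple.mem_ids.2 hid)⟩)

/-- The configurations of the machine between two look-ups, after the look-ups of `n` identifiers:
the known triples are those of the documents that have been retrieved. -/
def frontier (q : CLDQuery I L V) (c : Turing.ToPartrec.Code) (W : Web I L) (n : ℕ) :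
    Set (Config (State c) Cell) :=
  {κ | ∃ (known T : List (DataTriple I L)) (visited : List I) (w r : List Sym),
    κ ∈ ready c (Encodable.encode ((known, visited, []) : Memory I L)) w r [] ∧
    IsResponse r T ∧ (∀ b, (w ++ r).getLast? ≠ some (Sym.bit b)) ∧ visited.length = n ∧
    visited.Nodup ∧ (∀ u ∈ visited, q.Candidate W u) ∧
    ∀ t, t ∈ known ++ T ↔ ∃ u ∈ visited, ∃ d, W.adoc u = some d ∧ t ∈ W.data d}

theorem licensed_candidate (hv : ∀ u ∈ visited, q.Candidate W u)
    (hk : ∀ t, t ∈ known ↔ ∃ u ∈ visited, ∃ d, W.adoc u = some d ∧ t ∈ W.data d) {u : I}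
    (hu : q.Licensed known u) : q.Candidate W u := by
  rcases hu with hu | ⟨t, ht, hid, hc⟩
  · exact Or.inl hu
  · obtain ⟨u', hu', d, hd, ht⟩ := (hk t).1 ht
    exact Or.inr ⟨d, (hv u' hu').reachable hd, t, ht, hid, hc⟩

/-- If nothing licensed remains unvisited, the retrieved documents contain the seed documents and
are closed under licensed links, hence include every reachable one; candidacy gives the other
inclusion. -/
theorem mem_iff_mem_allData (hv : ∀ u ∈ visited, q.Candidate W u)
    (hk : ∀ t, t ∈ known ↔ ∃ u ∈ visited, ∃ d, W.adoc u = some d ∧ t ∈ W.data d)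
    (hl : ∀ u, q.Licensed known u → u ∈ visited) (t : DataTriple I L) :
    t ∈ known ↔ t ∈ (q.reachablePart W).allData := by
  rw [hk, mem_allData_reachablePart]
  constructor
  · rintro ⟨u, hu, d, hd, ht⟩
    exact ⟨d, (hv u hu).reachable hd, ht⟩
  · rintro ⟨d, hd, ht⟩
    suffices h : ∃ u ∈ visited, W.adoc u = some d by
      obtain ⟨u, hu, h⟩ := h
      exact ⟨u, hu, d, h, ht⟩
    clear ht
    induction hd with
    | seed u d hu hd => exact ⟨u, hl u (Or.inl hu), hd⟩
    | link d d' t u _ ht hid hc hd' ih =>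
      obtain ⟨v, hv, hd⟩ := ih
      exact ⟨u, hl u (Or.inr ⟨t, (hk t).2 ⟨v, hv, d, hd, ht⟩, hid, hc⟩), hd'⟩

/-- The response to the look-up of an identifier. -/
theorem isResponse_expandWord {w : List Sym} (hw : ∀ b, w.getLast? ≠ some (Sym.bit b)) (u : I) :
    ∃ T, IsResponse (expandWord I L W.enc
        ((w ++ encId L u).map fun s => some (Sum.inl (β := Cell) s))) T ∧
      ∀ t, t ∈ T ↔ ∃ d, W.adoc u = some d ∧ t ∈ W.data d := by
  -- The earlier word does not end in a digit, so the written code is the entire binary suffix.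
  have hsuf : HasBinarySuffix ((w ++ encId L u).map fun s => some (Sum.inl (β := Cell) s))
      (encId L u) := by
    refine ⟨w.map fun s => some (Sum.inl s), List.map_append, fun b hb => hw b ?_⟩
    simpa [List.getLast?_map] using hb
  have huniq {u'} (h : HasBinarySuffix ((w ++ encId L u).map fun s => some (Sum.inl (β := Cell) s))
      (encId L u')) : u' = u :=
    h.unique hsuf
  cases hd : W.adoc u with
  | none =>
    refine ⟨[], Or.inr ⟨rfl, Or.inr ?_⟩, by simp⟩
    rw [expandWord, dif_neg, List.nil_append]
    rintro ⟨x, hx⟩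
    obtain ⟨u', d, hw', hd', -⟩ := (isLookup_enc_iff W).1 hx
    rw [huniq hw', hd] at hd'
    exact absurd hd' (by simp)
  | some d =>
    refine ⟨sorted (W.data d), Or.inl ?_, fun t => ?_⟩
    · have h : ∃ x, IsLookup I L W.enc
          ((w ++ encId L u).map fun s => some (Sum.inl (β := Cell) s)) x :=
        ⟨_, (isLookup_enc_iff W).2 ⟨u, d, hsuf, hd, rfl⟩⟩
      rw [expandWord, dif_pos h]
      obtain ⟨u', d', hw', hd', hx⟩ := (isLookup_enc_iff W).1 h.choose_spec
      rw [huniq hw', hd, Option.some_inj] at hd'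
      rw [hx, ← hd']
      rfl
    · simp [sorted]

theorem getLast?_expandWord {A : Type} (w : List Sym) (v : List (TapeSym A)) (b : Bool) :
    (w ++ expandWord I L web v).getLast? ≠ some (Sym.bit b) := by
  rw [expandWord, ← List.append_assoc, List.getLast?_concat]
  simp

/-- One round of the traversal. -/
theorem IsCode.frontier_round (hc : q.IsCode c) {n : ℕ} {κ : Config (State c) Cell}
    (hκ : κ ∈ q.frontier c W n) :
    (∃ κ' ∈ q.frontier c W (n + 1), Reaches₁ (next I L c W.enc) κ κ') ∨
      ∃ κ', Reaches (next I L c W.enc) κ κ' ∧ next I L c W.enc κ' = none ∧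
        IsEncoding (BQP.vars q.P) (q.result W) κ'.out := by
  obtain ⟨known, T, visited, w, r, hκ, hr, hw, hn, hnd, hv, hk⟩ := hκ
  cases h : q.nextId (known ++ T) visited with
  | none =>
    obtain ⟨κ', h₁, h₂, h₃⟩ := hc.reaches_halt (web := W.enc) (known := known ++ T)
      (visited := visited) (q.resultWord (known ++ T)) hr (by simp [advance, plan, h]) hκ
    refine Or.inr ⟨κ', h₁, h₂, ?_⟩
    rw [h₃, List.nil_append]
    exact q.isEncoding_resultWord W
      (mem_iff_mem_allData hv hk fun u hu => q.mem_of_nextId_eq_none h hu)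
  | some u =>
    obtain ⟨hl, hu⟩ := q.nextId_eq_some h
    obtain ⟨κ', h₁, h₂⟩ := hc.leads_expand (web := W.enc) (known := known ++ T)
      (visited := visited ++ [u]) (encId L u) hr (by simp [advance, plan, h]) κ hκ
    obtain ⟨T', hT', hmem⟩ := isResponse_expandWord (W := W) hw u
    refine Or.inl ⟨κ', ⟨known ++ T, T', visited ++ [u], _, _, h₁, hT',
      getLast?_expandWord _ _, by simp [hn], ?_, fun v hv' => ?_, fun t => ?_⟩, h₂⟩
    · exact List.nodup_append.2 ⟨hnd, List.nodup_singleton u, by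
        rintro a ha b hb rfl
        exact hu (List.mem_singleton.1 hb ▸ ha)⟩
    · rcases List.mem_append.1 hv' with hv' | hv'
      · exact hv v hv'
      · rw [List.mem_singleton.1 hv']
        exact licensed_candidate hv hk hl
    · rw [List.mem_append, hk, hmem]
      simp only [List.mem_append, List.mem_singleton, or_and_right, exists_or, exists_eq_left]

theorem reaches_frontier (q : CLDQuery I L V) (c : Turing.ToPartrec.Code) (W : Web I L) :
    ∃ κ ∈ q.frontier c W 0, Reaches (next I L c W.enc) (machine c).init κ := by
  obtain ⟨κ, hκ, h⟩ := reaches_ready_init (I := I) (L := L) (c := c) W.enc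
  -- The initial memory 0 is the code of the triple of empty lists.
  exact ⟨κ, ⟨[], [], [], [], [], hκ, isResponse_nil, by simp, rfl, List.nodup_nil, by simp,
    by simp⟩, h⟩

/-- No finiteness of the reachable part is assumed: induction along the halting run shows that it
must leave the frontier through the output phase. -/
theorem IsCode.computes (hc : q.IsCode c) : (machine c).Computes q := by
  rintro W out ⟨κ, hκ, hnone, rfl⟩
  have key : ∀ κ₀, κ ∈ eval (next I L c W.enc) κ₀ → ∀ n, ∀ κ' ∈ q.frontier c W n,
      Reaches (next I L c W.enc) κ₀ κ' → IsEncoding (BQP.vars q.P) (q.result W) κ.out := by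
    intro κ₀ h
    refine evalInduction (C := fun κ₀ => ∀ n, ∀ κ' ∈ q.frontier c W n,
      Reaches (next I L c W.enc) κ₀ κ' → IsEncoding (BQP.vars q.P) (q.result W) κ.out) h
      fun κ₀ h ih => ?_
    have hstep : ∀ n, ∀ κ' ∈ q.frontier c W n, Reaches₁ (next I L c W.enc) κ₀ κ' →
        IsEncoding (BQP.vars q.P) (q.result W) κ.out := by
      intro n κ' hκ' hr
      obtain ⟨κ₁, h₁, h₂⟩ := Relation.TransGen.head'_iff.1 hr
      exact ih κ₁ h₁ n κ' hκ' h₂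
    intro n κ' hκ' hr
    rcases Relation.reflTransGen_iff_eq_or_transGen.1 hr with rfl | hr
    -- Either the next frontier lies at least one step ahead, so the induction hypothesis applies,
    -- or the run halts here and determinism identifies the final configurations.
    · rcases hc.frontier_round hκ' with ⟨κ₁, h₁, h₂⟩ | ⟨κ₁, h₁, h₂, h₃⟩
      · exact hstep _ κ₁ h₁ h₂
      · rwa [Part.mem_unique h (mem_eval.2 ⟨h₁, h₂⟩)]
    · exact hstep n κ' hκ' hr
  obtain ⟨κ', hκ', hr⟩ := reaches_frontier q c W
  exact key _ (mem_eval.2 ⟨hκ, hnone⟩) 0 κ' hκ' hr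

theorem IsCode.haltsOn (hc : q.IsCode c) (hW : (q.reachablePart W).IsFinite) :
    (machine c).HaltsOn W := by
  have hlen : ∀ n, (q.frontier c W n).Nonempty → n ≤ (finite_candidate hW).toFinset.card := by
    classical
    rintro _ ⟨κ, _, _, visited, _, _, _, _, _, rfl, hnd, hv, _⟩
    rw [← List.toFinset_card_of_nodup hnd]
    exact Finset.card_le_card fun u hu => by simpa using hv u (by simpa using hu)
  -- Here `k` is fuel: by `hlen` there is no frontier configuration once `n` exceeds the number of
  -- candidates.
  have key : ∀ k n, (finite_candidate hW).toFinset.card < n + k → ∀ κ ∈ q.frontier c W n,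
      ∃ κ', Reaches (next I L c W.enc) κ κ' ∧ next I L c W.enc κ' = none := by
    intro k
    induction k with
    | zero =>
      intro n hn κ hκ
      exact absurd (hlen n ⟨κ, hκ⟩) (by omega)
    | succ k ih =>
      intro n hn κ hκ
      rcases hc.frontier_round hκ with ⟨κ₁, h₁, h₂⟩ | ⟨κ₁, h₁, h₂, _⟩
      · obtain ⟨κ', h₃, h₄⟩ := ih (n + 1) (by omega) κ₁ h₁
        exact ⟨κ', h₂.to_reflTransGen.trans h₃, h₄⟩
      · exact ⟨κ₁, h₁, h₂⟩
  obtain ⟨κ, hκ, hr⟩ := reaches_frontier q c W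
  obtain ⟨κ', h₁, h₂⟩ := key (_ + 1) 0 (by rw [Nat.zero_add]; exact Nat.lt_succ_self _) κ hκ
  exact ⟨κ'.out, κ', hr.trans h₁, h₂, rfl⟩

end CLDQuery

end LinkedData

theorem mainTheorem4 {I L V : Type} [Denumerable I] [Denumerable L] [Denumerable V]
    (q : LinkedData.CLDQuery I L V) :
    (∃ M : LinkedData.LDMachine, M.Computes q ∧
      ∀ W : LinkedData.Web I L, (q.reachablePart W).IsFinite → M.HaltsOn W) ∧
    ((LinkedData.BQP.vars q.P).Nonempty →
      ∀ W : LinkedData.Web I L,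
        (∃ M : LinkedData.LDMachine, M.Computes q ∧ M.HaltsOn W) ↔
          (q.reachablePart W).IsFinite) := by
  obtain ⟨c, hc⟩ := q.exists_isCode
  refine ⟨⟨_, hc.computes, fun W hW => hc.haltsOn hW⟩, fun hP W =>
    ⟨fun ⟨M, hM, hW⟩ => hM.reachablePart_isFinite hP hW, fun hW => ⟨_, hc.computes, hc.haltsOn hW⟩⟩⟩
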